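/- A context-free grammar is a triple $(N,\Sigma,P)$ with a finite set $N$ of non-terminals, a set $\Sigma$ of alphabet symbols disjoint from $N$, and a finite set $P$ of production rules, each of the form $a\to\sigma$ or $a\to b\,c$ with $a,b,c\in N$ and $\sigma\in\Sigma$. For a set $Q$ of rules write $\Rightarrow_Q^*$ (resp. $\Rightarrow_Q^+$) for rewriting with rules of $Q$ in zero or more (resp. one or more) steps; $L(a)=\{w\in\Sigma^* : a\Rightarrow_P^* w\}$; and $\mathrm{heads}(Q)$ for the set of left-hand sides of rules in $Q$. The set $Q$ is *deterministic non-recursive* if for every $a\in\mathrm{heads}(Q)$: there are no strings $s_1,s_2$ over $N\cup\Sigma$ with $a\Rightarrow_Q^+ s_1 a s_2$; exactly one rule of $Q$ has left-hand side $a$; and $a\Rightarrow_Q^* w$ for some $w\in\Sigma^*$. A subset $P'\subseteq P$ is *minimizing* if it is deterministic non-recursive and each $a\in N$ with $L(a)\ne\emptyset$ is rewritten by $P'$ into a unique string over $\Sigma$, whose length is $\min\{|w| : w\in L(a)\}$. **Algorithm 1.** Maintain partial mappings $\mathrm{cost}$ from $N$ to integers and $P'$ from $N$ to rules, and a min-priority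 queue $\mathrm{new}$ of non-terminals, all initially empty. 1. For each rule $(a\to\sigma)\in P$: if $a\notin\mathrm{cost}$, set $\mathrm{cost}[a]:=1$, $P'[a]:=(a\to\sigma)$ and add $a$ to $\mathrm{new}$ with priority $1$. 2. While $\mathrm{new}\neq\emptyset$: remove from $\mathrm{new}$ an element $a$ of minimum priority; for each rule $(c\to a\,b)\in P$ with $b\in\mathrm{cost}$ call $\mathrm{produce}(c\to a\,b)$; then for each rule $(c\to b\,a)\in P$ with $b\in\mathrm{cost}$ call $\mathrm{produce}(c\to b\,a)$. 3. Return $\{P'[a] : a\in P'\}$. Here $\mathrm{produce}(d\to e\,f)$ computes $k=\mathrm{cost}[e]+\mathrm{cost}[f]$. If $d\notin\mathrm{cost}$, it sets $\mathrm{cost}[d]:=k$, $P'[d]:=(d\to e\,f)$ and adds $d$ to $\mathrm{new}$ with priority $k$; otherwise, if $\mathrm{cost}[d]>k$, it sets $\mathrm{cost}[d]:=k$, $P'[d]:=(d\to e\,f)$ and lowers the priority of $d$ in $\mathrm{new}$ to $k$. **Theorem.** Let $\mathrm{new}$ be implemented as a Fibonacci heap. Count steps on a random access machine on which accessing one array cell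 (holding a non-terminal, a rule, a flag, a degree, or a list header), inserting into or removing a given node from a doubly linked list, detaching a list, and visiting one list element each take one step, while reading, writing, comparing, or adding costs and priorities (non-negative binary integers) takes one step plus the total number of bits of the integers involved. There is a constant $C$ such that for every context-free grammar $(N,\Sigma,P)$, and every order in which $P$ is listed in the input, Algorithm 1 terminates, returns a minimizing set of production rules for the grammar, and performs at most $$C\cdot\bigl(|N|\,(|N|\log|N|+|P|)+1\bigr)$$ steps (with $|N|\log|N|=0$ for $|N|=0$), that is, it runs in time $\mathcal O(|N|(|N|\log|N|+|P|))$. -/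

import Mathlib

/-! Context-free grammars in Chomsky normal form, minimizing sets of production rules, and
a step-counted implementation of the priority-queue algorithm that constructs such a set. -/

namespace MinCFG

/-! ### Grammars and derivations

A grammar `(N, T, P)` has the type `N` of non-terminals, the type `T` of alphabet symbols and the
set `P` of production rules. -/

/-- A production rule `a ⟶ t` or `a ⟶ b c`. -/
inductive Rule (N T : Type) : Type
  | term (a : N) (t : T) : Rule N T
  | pair (a b c : N) : Rule N T

/-- The left-hand side of a rule. -/
def Rule.head {N T : Type} : Rule N T → N
  | .term a _ => a
  | .pair a _ _ => a

/-- The rule as a rewrite rule on strings over non-terminals and alphabet symbols. -/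
def Rule.toContextFreeRule {N T : Type} : Rule N T → ContextFreeRule T N
  | .term a t => ⟨a, [.terminal t]⟩
  | .pair a b c => ⟨a, [.nonterminal b, .nonterminal c]⟩

/-- One rewrite step with a rule of `P`. -/
def Step {N T : Type} (P : Set (Rule N T)) (u v : List (Symbol T N)) : Prop :=
  ∃ r ∈ P, r.toContextFreeRule.Rewrites u v

/-- Rewriting in finitely many (possibly zero) steps. -/
def Derives {N T : Type} (P : Set (Rule N T)) : List (Symbol T N) → List (Symbol T N) → Prop :=
  Relation.ReflTransGen (Step P)

/-- Rewriting in at least one step. -/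
def DerivesPlus {N T : Type} (P : Set (Rule N T)) :
    List (Symbol T N) → List (Symbol T N) → Prop :=
  Relation.TransGen (Step P)

/-- The language of the grammar with rules `P` with respect to the non-terminal `a`. -/
def languageOf {N T : Type} (P : Set (Rule N T)) (a : N) : Language T :=
  {w | Derives P [.nonterminal a] (w.map .terminal)}

/-- `m` is the least length of a string of the language `L`. -/
def IsMinLength {T : Type} (L : Language T) (m : ℕ) : Prop :=
  IsLeast {k | ∃ w ∈ L, w.length = k} m

/-- The non-terminals that have a rule in `P`. -/
def heads {N T : Type} (P : Set (Rule N T)) : Set N :=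
  {a | ∃ r ∈ P, r.head = a}

/-- The non-terminals derivable from `a` in at least one step. -/
def derivableNonterminals {N T : Type} (P : Set (Rule N T)) (a : N) : Set N :=
  {b | ∃ s₁ s₂ : List (Symbol T N),
    DerivesPlus P [.nonterminal a] (s₁ ++ [.nonterminal b] ++ s₂)}

/-- No non-terminal with a rule in `P` is derivable from itself. -/
def NonRecursive {N T : Type} (P : Set (Rule N T)) : Prop :=
  ∀ a ∈ heads P, a ∉ derivableNonterminals P a

/-- `P` is a deterministic non-recursive set of rules. -/
structure DetNonRecursive {N T : Type} (P : Set (Rule N T)) : Prop where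
  nonRecursive : NonRecursive P
  deterministic : ∀ a ∈ heads P, ∃! r, r ∈ P ∧ r.head = a
  productive : ∀ a ∈ heads P, ∃ w : List T, Derives P [.nonterminal a] (w.map .terminal)

/-- `w` is the unique string over the alphabet into which `P` rewrites `a`. -/
def IsUniqueString {N T : Type} (P : Set (Rule N T)) (a : N) (w : List T) : Prop :=
  Derives P [.nonterminal a] (w.map .terminal) ∧
    ∀ w' : List T, Derives P [.nonterminal a] (w'.map .terminal) → w' = w

/-- `S` is a minimizing set of production rules for the grammar with rules `P`: it is a
deterministic non-recursive subset of `P` that rewrites each `a` with non-empty language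
into a string of minimum length in the language of `a`. -/
structure IsMinimizing {N T : Type} (P S : Set (Rule N T)) : Prop where
  subset : S ⊆ P
  detNonRecursive : DetNonRecursive S
  minimal : ∀ a : N, (∃ w, w ∈ languageOf P a) →
    ∃ w : List T, IsUniqueString S a w ∧ IsMinLength (languageOf P a) w.length

/-! ### Machine memory and elementary steps

A random access machine with arrays indexed by non-terminals. Accessing an array cell that
holds a non-terminal, a rule, a flag, a degree or a list header is one step. Costs and priorities
are binary integers, and each operation on them takes a number of steps that is linear in
the number of their bits. The lists of the heap are circular doubly linked lists (with each node
containing its own links), so that insertion, removal of a given node, and detaching the list are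
single steps, and traversing a list takes one step per element in addition to the work done
on the elements. -/

/-- The memory, with the number of steps done so far in `clock`. -/
structure Mem (N T : Type) : Type where
  clock : ℕ
  /-- the partial mapping `cost` -/
  cost : N → Option ℕ
  /-- the partial mapping `P'` -/
  chosen : N → Option (Rule N T)
  /-- at `a`: the pairs `(c, b)` with a rule `c ⟶ a b` -/
  withFirst : N → List (N × N)
  /-- at `a`: the pairs `(c, b)` with a rule `c ⟶ b a` -/
  withSecond : N → List (N × N)
  /-- Fibonacci heap: the priority of a node -/
  key : N → ℕ
  /-- Fibonacci heap: the parent of a node -/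
  parent : N → Option N
  /-- Fibonacci heap: the list of children of a node -/
  children : N → List N
  /-- Fibonacci heap: the number of children of a node -/
  degree : N → ℕ
  /-- Fibonacci heap: whether a node has lost a child since it became a child itself -/
  mark : N → Bool
  /-- Fibonacci heap: the list of roots -/
  roots : List N
  /-- Fibonacci heap: a root of minimum priority -/
  minRoot : Option N
  /-- auxiliary array, indexed by degrees, used to consolidate the heap -/
  slot : ℕ → Option N
  /-- the length of the part of the auxiliary array that is in use -/
  top : ℕ

/-- The empty memory. -/
def Mem.blank (N T : Type) : Mem N T where
  clock := 0
  cost := fun _ => none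
  chosen := fun _ => none
  withFirst := fun _ => []
  withSecond := fun _ => []
  key := fun _ => 0
  parent := fun _ => none
  children := fun _ => []
  degree := fun _ => 0
  mark := fun _ => false
  roots := []
  minRoot := none
  slot := fun _ => none
  top := 0

/-- Programs: partial functions on memories; a run that does not terminate has no value. -/
abbrev Prog (N T : Type) := StateT (Mem N T) Option

/-- Spend `k` steps. -/
def charge {N T : Type} (k : ℕ) : Prog N T Unit :=
  modify fun s => { s with clock := s.clock + k }

/-- Read a memory cell. -/
def rd {N T α : Type} (f : Mem N T → α) : Prog N T α := do
  charge 1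
  let s ← get
  return f s

/-- Write a memory cell, or do an elementary update of a linked list. -/
def wr {N T : Type} (f : Mem N T → Mem N T) : Prog N T Unit := do
  charge 1
  modify f

/-- Read an integer, bit by bit. -/
def rdInt {N T : Type} (f : Mem N T → ℕ) : Prog N T ℕ := do
  let s ← get
  charge (1 + (f s).size)
  return f s

/-- Write the integer `k`, bit by bit. -/
def wrInt {N T : Type} (k : ℕ) (f : ℕ → Mem N T → Mem N T) : Prog N T Unit := do
  charge (1 + k.size)
  modify (f k)

/-- Compare two integers, bit by bit. -/
def less {N T : Type} (x y : ℕ) : Prog N T Bool := do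
  charge (1 + x.size + y.size)
  return decide (x < y)

/-- Add two integers, bit by bit. -/
def plus {N T : Type} (x y : ℕ) : Prog N T ℕ := do
  charge (1 + x.size + y.size)
  return x + y

/-- Traverse a list. -/
def forEach {N T α : Type} (body : α → Prog N T Unit) : List α → Prog N T Unit
  | [] => charge 1
  | x :: l => do
    charge 1
    body x
    forEach body l

/-- The loop "repeat `x ← body x` until `body` returns `none`", stopped without a value if it
does not end within `k` rounds. -/
def loopUpTo {N T α : Type} (body : α → Prog N T (Option α)) : ℕ → α → Prog N T Unit
  | 0, _ => fun _ => none
  | k + 1, x => do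
    match ← body x with
    | none => pure ()
    | some y => loopUpTo body k y

open Classical in
/-- The loop "repeat `x ← body x` until `body` returns `none`". It has a value exactly if
it ends after some number of rounds. -/
noncomputable def loop {N T α : Type} (body : α → Prog N T (Option α)) (x : α) :
    Prog N T Unit := fun s =>
  if h : ∃ k, (loopUpTo body k x s).isSome then loopUpTo body (Nat.find h) x s else none

theorem loopUpTo_succ {N T α : Type} (body : α → Prog N T (Option α)) (k : ℕ) (x : α)
    (s : Mem N T) (r : Unit × Mem N T) (h : loopUpTo body k x s = some r) :
    loopUpTo body (k + 1) x s = some r := by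
  induction k generalizing x s with
  | zero => simp [loopUpTo] at h
  | succ k ih =>
    rw [loopUpTo] at h ⊢
    simp only [bind, StateT.bind] at h ⊢
    cases hb : body x s with
    | none => simp [hb] at h
    | some p =>
      obtain ⟨o, s'⟩ := p
      cases o with
      | none => simpa [hb] using h
      | some y =>
        simp only [hb, Option.bind_some] at h ⊢
        exact ih y s' h

/-- The value of a loop does not depend on how the bound on the number of rounds is chosen. -/
theorem loop_eq_of_loopUpTo {N T α : Type} (body : α → Prog N T (Option α)) (k : ℕ) (x : α)
    (s : Mem N T) (r : Unit × Mem N T) (h : loopUpTo body k x s = some r) :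
    loop body x s = some r := by
  classical
  have hex : ∃ k, (loopUpTo body k x s).isSome := ⟨k, by simp [h]⟩
  have hl : loop body x s = loopUpTo body (Nat.find hex) x s := by
    unfold loop
    rw [dif_pos hex]
  obtain ⟨r', hr'⟩ := Option.isSome_iff_exists.mp (Nat.find_spec hex)
  have hmono : ∀ j, loopUpTo body (Nat.find hex + j) x s = some r' := by
    intro j
    induction j with
    | zero => exact hr'
    | succ j ih => exact loopUpTo_succ body _ x s r' ih
  have hle : Nat.find hex ≤ k := Nat.find_min' hex (by simp [h])
  have hk := hmono (k - Nat.find hex)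
  rw [Nat.add_sub_cancel' hle, h] at hk
  rw [hl, hr', hk]

/-! ### Fibonacci heap

The nodes of the heap are the non-terminals. -/

/-- Add the tree with root `x` to the list of roots and update the minimum. -/
def addRoot {N T : Type} (x : N) : Prog N T Unit := do
  wr fun s => { s with roots := x :: s.roots }
  match ← rd (·.minRoot) with
  | none => wr fun s => { s with minRoot := some x }
  | some m =>
    let kx ← rdInt (·.key x)
    let km ← rdInt (·.key m)
    if ← less kx km then
      wr fun s => { s with minRoot := some x }

/-- Insert `x` with priority `k`. -/
def insert {N T : Type} [DecidableEq N] (x : N) (k : ℕ) : Prog N T Unit := do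
  wrInt k fun k s => { s with key := Function.update s.key x k }
  wr fun s => { s with parent := Function.update s.parent x none }
  wr fun s => { s with children := Function.update s.children x [] }
  wr fun s => { s with degree := Function.update s.degree x 0 }
  wr fun s => { s with mark := Function.update s.mark x false }
  addRoot x

/-- Make the root `y` a child of the root `x`. -/
def link {N T : Type} [DecidableEq N] (y x : N) : Prog N T Unit := do
  wr fun s => { s with children := Function.update s.children x (y :: s.children x) }
  wr fun s => { s with degree := Function.update s.degree x (s.degree x + 1) }
  wr fun s => { s with parent := Function.update s.parent y (some x) }
  wr fun s => { s with mark := Function.update s.mark y false }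

/-- Put the tree with root `x` into the auxiliary array, linking it with trees of equal degree. -/
noncomputable def place {N T : Type} [DecidableEq N] : N → Prog N T Unit := loop fun x => do
  let d ← rd (·.degree x)
  match ← rd (·.slot d) with
  | none =>
    wr fun s => { s with slot := Function.update s.slot d (some x) }
    wr fun s => { s with top := max s.top (d + 1) }
    return none
  | some y =>
    wr fun s => { s with slot := Function.update s.slot d none }
    let kx ← rdInt (·.key x)
    let ky ← rdInt (·.key y)
    if ← less ky kx then
      link x y
      return some y
    else
      link y x
      return some x

/-- Link roots of equal degree until all roots have distinct degrees. -/
noncomputable def consolidate {N T : Type} [DecidableEq N] : Prog N T Unit := do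
  let rs ← rd (·.roots)
  wr fun s => { s with roots := [] }
  wr fun s => { s with minRoot := none }
  forEach place rs
  let t ← rd (·.top)
  forEach (fun d => do
    match ← rd (·.slot d) with
    | none => pure ()
    | some x =>
      wr fun s => { s with slot := Function.update s.slot d none }
      addRoot x) (List.range t)
  wr fun s => { s with top := 0 }

/-- Remove and return an element of minimum priority (`none` if the heap is empty). -/
noncomputable def extractMin {N T : Type} [DecidableEq N] : Prog N T (Option N) := do
  match ← rd (·.minRoot) with
  | none => return none
  | some z =>
    let cs ← rd (·.children z)
    forEach (fun x => do
      wr fun s => { s with parent := Function.update s.parent x none }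
      wr fun s => { s with roots := x :: s.roots }) cs
    wr fun s => { s with children := Function.update s.children z [] }
    wr fun s => { s with degree := Function.update s.degree z 0 }
    wr fun s => { s with roots := s.roots.erase z }
    consolidate
    return some z

/-- Cut `x` from its parent `y` and make it a root. -/
def cut {N T : Type} [DecidableEq N] (x y : N) : Prog N T Unit := do
  wr fun s => { s with children := Function.update s.children y ((s.children y).erase x) }
  wr fun s => { s with degree := Function.update s.degree y (s.degree y - 1) }
  wr fun s => { s with roots := x :: s.roots }
  wr fun s => { s with parent := Function.update s.parent x none }
  wr fun s => { s with mark := Function.update s.mark x false }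

/-- After `y` has lost a child: mark `y`, or cut it too if it was marked before. -/
noncomputable def cascadingCut {N T : Type} [DecidableEq N] : N → Prog N T Unit := loop fun y => do
  match ← rd (·.parent y) with
  | none => return none
  | some z =>
    if ← rd (·.mark y) then
      cut y z
      return some z
    else
      wr fun s => { s with mark := Function.update s.mark y true }
      return none

/-- Lower the priority of `x` to `k`. -/
noncomputable def decreaseKey {N T : Type} [DecidableEq N] (x : N) (k : ℕ) : Prog N T Unit := do
  wrInt k fun k s => { s with key := Function.update s.key x k }
  match ← rd (·.parent x) with
  | none => pure ()
  | some y =>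
    let ky ← rdInt (·.key y)
    if ← less k ky then
      cut x y
      cascadingCut y
  match ← rd (·.minRoot) with
  | none => pure ()
  | some m =>
    let km ← rdInt (·.key m)
    if ← less k km then
      wr fun s => { s with minRoot := some x }

/-! ### The algorithm -/

/-- Set `cost[a]` to `k` and `P'[a]` to `r`. -/
def record {N T : Type} [DecidableEq N] (a : N) (k : ℕ) (r : Rule N T) : Prog N T Unit := do
  wrInt k fun k s => { s with cost := Function.update s.cost a (some k) }
  wr fun s => { s with chosen := Function.update s.chosen a (some r) }

/-- Test whether `a` is in `cost`. -/
def hasCost {N T : Type} (a : N) : Prog N T Bool :=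
  rd fun s => (s.cost a).isSome

/-- Read `cost[a]` (used only if `a` is in `cost`). -/
def rdCost {N T : Type} (a : N) : Prog N T ℕ :=
  rdInt fun s => (s.cost a).getD 0

/-- The procedure `produce` on the rule `d ⟶ e f`. -/
noncomputable def produce {N T : Type} [DecidableEq N] (d e f : N) : Prog N T Unit := do
  let ce ← rdCost e
  let cf ← rdCost f
  let k ← plus ce cf
  if ← hasCost d then
    let cd ← rdCost d
    if ← less k cd then
      record d k (.pair d e f)
      decreaseKey d k
  else
    record d k (.pair d e f)
    insert d k

/-- Store, for each non-terminal, the rules in which it occurs on the right-hand side. -/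
def buildIndex {N T : Type} [DecidableEq N] : List (Rule N T) → Prog N T Unit :=
  forEach fun r =>
    match r with
    | .term _ _ => pure ()
    | .pair c a b => do
      wr fun s => { s with
        withFirst := Function.update s.withFirst a ((c, b) :: s.withFirst a) }
      wr fun s => { s with
        withSecond := Function.update s.withSecond b ((c, a) :: s.withSecond b) }

/-- The first `for`-loop. -/
def firstLoop {N T : Type} [DecidableEq N] : List (Rule N T) → Prog N T Unit :=
  forEach fun r =>
    match r with
    | .pair _ _ _ => pure ()
    | .term a t => do
      if ← hasCost a then
        pure ()
      else
        record a 1 (.term a t)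
        insert a 1

/-- The `while`-loop. -/
noncomputable def mainLoop {N T : Type} [DecidableEq N] : Unit → Prog N T Unit := loop fun _ => do
  match ← extractMin with
  | none => return none
  | some a =>
    let fs ← rd (·.withFirst a)
    forEach (fun p => do
      if ← hasCost p.2 then
        produce p.1 a p.2) fs
    let ss ← rd (·.withSecond a)
    forEach (fun p => do
      if ← hasCost p.2 then
        produce p.1 p.2 a) ss
    return some ()

/-- The algorithm, on the production rules listed in `L`. The first line accounts for the allocation
of the nine arrays indexed by non-terminals and of the auxiliary array, and the
last `charge` for collecting the returned set. -/
noncomputable def algorithm {N T : Type} [Fintype N] [DecidableEq N] (L : List (Rule N T)) :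
    Prog N T (Set (Rule N T)) := do
  charge (1 + 10 * Fintype.card N)
  buildIndex L
  firstLoop L
  mainLoop ()
  charge (Fintype.card N)
  let s ← get
  return {r | ∃ a, s.chosen a = some r}

end MinCFG

namespace MinCFG

/-! Correctness follows the pattern of Dijkstra's algorithm, in Knuth's generalisation to grammars.
A rule `c ⟶ a b` offers `c` the sum of two costs, both at least 1, so the offer exceeds each of
them. Hence non-terminals leave the queue in order of non-decreasing cost, and a cost is final once
its non-terminal has left; `Inv` records this. When the queue is empty, no rule of `P` whose
right-hand side has costs improves its head, and the chosen rules attain the costs (`Inv.le_of_rhs`,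
`Inv.value_eq`).

The grammatical claims then follow by weighing symbols. With weight 1 for alphabet symbols, the cost
for non-terminals and `⊤` where there is no cost, no rule of `P` lowers the weight of a string, so
costs are lower bounds for lengths (`Inv.value_le_length`). Along chosen rules the cost strictly
drops from head to right-hand side, which excludes recursion and lets the rules be unfolded to
strings whose lengths are the costs (`Inv.derives`). Replacing each non-terminal by its unfolded
string is invariant under the chosen rules, which gives uniqueness (`Inv.isMinimizing`).

The time bound is the amortized analysis of Fibonacci heaps, measured in multiples of `unit N`. Each
non-terminal that newly receives a cost at most doubles the bound for all costs, so costs are at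
most `2 ^ |N|` and have at most `|N| + 1` bits. Constantly many integer operations thus take
`O(|N|)` steps, which is the outer factor in the bound. The potential is three units per tree and
four per marked node. A child has at most as many older siblings as its degree, plus one if it is
marked; therefore a node of degree `d` has at least `fib (d + 2)` descendants and degrees are
logarithmic (`Forest.fib_le_card`, `Forest.degree_le`). Insertion and lowering a priority cost
`O(1)` units, removing a minimum costs `O(log |N|)` units (`insert_spec`, `decreaseKey_spec`,
`extractMin_spec`). Each non-terminal is removed at most once and each rule is met at most twice
after removals, so `mainLoop_spec` totals `O(|N| log |N| + |P|)` units.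

Termination and cost are proved together: the step counter is part of the memory, and `wp` asserts
total correctness. -/

/-- The program `p`, started in `s`, terminates with a value and a memory that satisfy `Q`. -/
def wp {N T α : Type} (p : Prog N T α) (Q : α → Mem N T → Prop) (s : Mem N T) : Prop :=
  ∃ a s', p s = some (a, s') ∧ Q a s'

/-! ### A weakest-precondition calculus for counted programs. -/

section wp
variable {N T α β : Type}

theorem wp_mono {p : Prog N T α} {Q Q' : α → Mem N T → Prop} {s : Mem N T}
    (h : wp p Q s) (hQ : ∀ a s', Q a s' → Q' a s') : wp p Q' s := by
  obtain ⟨a, s', h1, h2⟩ := h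
  exact ⟨a, s', h1, hQ _ _ h2⟩

theorem wp_bind (p : Prog N T α) (f : α → Prog N T β) (Q : β → Mem N T → Prop) (s : Mem N T) :
    wp (p >>= f) Q s ↔ wp p (fun a s' => wp (f a) Q s') s := by
  simp only [wp, bind, StateT.bind]
  cases h : p s with
  | none => simp
  | some r => obtain ⟨a, s'⟩ := r; simp

theorem wp_pure (a : α) (Q : α → Mem N T → Prop) (s : Mem N T) :
    wp (pure a : Prog N T α) Q s ↔ Q a s := by
  simp [wp, pure, StateT.pure]

theorem wp_get (Q : Mem N T → Mem N T → Prop) (s : Mem N T) :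
    wp (get : Prog N T (Mem N T)) Q s ↔ Q s s := by
  simp [wp, get, getThe, MonadStateOf.get, StateT.get, pure]

theorem wp_modify (f : Mem N T → Mem N T) (Q : PUnit → Mem N T → Prop) (s : Mem N T) :
    wp (modify f : Prog N T PUnit) Q s ↔ Q () (f s) := by
  constructor
  · rintro ⟨_, _, h, hQ⟩
    cases h
    exact hQ
  · exact fun h => ⟨_, _, rfl, h⟩

theorem wp_charge (k : ℕ) (Q : Unit → Mem N T → Prop) (s : Mem N T) :
    wp (charge k) Q s ↔ Q () { s with clock := s.clock + k } :=
  wp_modify _ _ _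

theorem wp_rd (f : Mem N T → α) (Q : α → Mem N T → Prop) (s : Mem N T) :
    wp (rd f) Q s ↔ Q (f { s with clock := s.clock + 1 }) { s with clock := s.clock + 1 } := by
  simp only [rd, wp_bind, wp_charge, wp_get, wp_pure]

theorem wp_wr (f : Mem N T → Mem N T) (Q : Unit → Mem N T → Prop) (s : Mem N T) :
    wp (wr f) Q s ↔ Q () (f { s with clock := s.clock + 1 }) := by
  simp only [wr, wp_bind, wp_charge, wp_modify]

theorem wp_rdInt (f : Mem N T → ℕ) (Q : ℕ → Mem N T → Prop) (s : Mem N T) :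
    wp (rdInt f) Q s ↔ Q (f s) { s with clock := s.clock + (1 + (f s).size) } := by
  simp only [rdInt, wp_bind, wp_charge, wp_get, wp_pure]

theorem wp_wrInt (k : ℕ) (f : ℕ → Mem N T → Mem N T) (Q : Unit → Mem N T → Prop) (s : Mem N T) :
    wp (wrInt k f) Q s ↔ Q () (f k { s with clock := s.clock + (1 + k.size) }) := by
  simp only [wrInt, wp_bind, wp_charge, wp_modify]

theorem wp_less (x y : ℕ) (Q : Bool → Mem N T → Prop) (s : Mem N T) :
    wp (less x y) Q s ↔
      Q (decide (x < y)) { s with clock := s.clock + (1 + x.size + y.size) } := by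
  simp only [less, wp_bind, wp_charge, wp_pure]

theorem wp_plus (x y : ℕ) (Q : ℕ → Mem N T → Prop) (s : Mem N T) :
    wp (plus x y) Q s ↔ Q (x + y) { s with clock := s.clock + (1 + x.size + y.size) } := by
  simp only [plus, wp_bind, wp_charge, wp_pure]

theorem wp_ite (c : Prop) [Decidable c] (p q : Prog N T α) (Q : α → Mem N T → Prop)
    (s : Mem N T) : wp (if c then p else q) Q s ↔ if c then wp p Q s else wp q Q s := by
  split_ifs <;> rfl

/-- Rule for traversals, with an invariant that depends on the part of the list that is left. -/
theorem wp_forEach {body : α → Prog N T Unit} (I : List α → Mem N T → Prop)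
    (hbody : ∀ x l s, I (x :: l) s →
      wp (body x) (fun _ s' => I l s') { s with clock := s.clock + 1 }) :
    ∀ (l : List α) (s : Mem N T), I l s →
      wp (forEach body l) (fun _ s' => ∃ s₀, I [] s₀ ∧ s' = { s₀ with clock := s₀.clock + 1 }) s
  | [], s, h => by
    rw [forEach, wp_charge]
    exact ⟨s, h, rfl⟩
  | x :: l, s, h => by
    rw [forEach, wp_bind, wp_charge, wp_bind]
    exact wp_mono (hbody x l s h) fun _ s' h' => wp_forEach I hbody l s' h'

/-- Rule for loops, with an invariant that is indexed by a bound for the number of rounds. -/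
theorem wp_loop_of_index {body : α → Prog N T (Option α)} {Q : Unit → Mem N T → Prop}
    (I : ℕ → α → Mem N T → Prop)
    (hbody : ∀ n x s, I n x s →
      wp (body x) (fun o s' => match o with
        | none => Q () s'
        | some y => ∃ m < n, I m y s') s)
    (n : ℕ) (x : α) (s : Mem N T) (h : I n x s) : wp (loop body x) Q s := by
  -- The index `n` allows `n` rounds that continue; the additional round is the one in which the
  -- body returns `none`.
  suffices H : wp (loopUpTo body (n + 1) x) Q s by
    obtain ⟨a, s', h1, h2⟩ := H
    exact ⟨a, s', loop_eq_of_loopUpTo body _ x s _ h1, h2⟩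
  suffices H : ∀ k n x s, n ≤ k → I n x s → wp (loopUpTo body (k + 1) x) Q s from
    H n n x s le_rfl h
  intro k
  induction k with
  | zero =>
    intro n x s hn hI
    rw [loopUpTo, wp_bind]
    refine wp_mono (hbody n x s hI) fun o s' ho => ?_
    cases o with
    | none => exact (wp_pure _ _ _).2 ho
    | some y =>
      obtain ⟨m, hm, -⟩ := ho
      omega
  | succ k ih =>
    intro n x s hn hI
    rw [loopUpTo, wp_bind]
    refine wp_mono (hbody n x s hI) fun o s' ho => ?_
    cases o with
    | none => exact (wp_pure _ _ _).2 ho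
    | some y =>
      obtain ⟨m, hm, hy⟩ := ho
      exact ih m y s' (by omega) hy

/-- Rule for loops, with an invariant and a measure that decreases in each round. -/
theorem wp_loop {body : α → Prog N T (Option α)} {Q : Unit → Mem N T → Prop}
    (I : α → Mem N T → Prop) (m : α → Mem N T → ℕ)
    (hbody : ∀ x s, I x s →
      wp (body x) (fun o s' => match o with
        | none => Q () s'
        | some y => I y s' ∧ m y s' < m x s) s)
    (x : α) (s : Mem N T) (h : I x s) : wp (loop body x) Q s := by
  refine wp_loop_of_index (fun n x s => I x s ∧ m x s = n) ?_ _ x s ⟨h, rfl⟩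
  rintro _ x s ⟨hI, rfl⟩
  refine wp_mono (hbody x s hI) fun o s' ho => ?_
  cases o with
  | none => exact ho
  | some y => exact ⟨_, ho.2, ho.1, rfl⟩

end wp
-- Heap-ordered forests and the Fibonacci bound for degrees.
section forest
variable {N : Type}

/-- Each element `y` of the list has at most `g y` elements after it. -/
def Layered (g : N → ℕ) : List N → Prop
  | [] => True
  | y :: l => l.length ≤ g y ∧ Layered g l

theorem Layered.mono {g g' : N → ℕ} : ∀ {l : List N}, Layered g l → (∀ y ∈ l, g y ≤ g' y) →
    Layered g' l
  | [], _, _ => trivial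
  | y :: _, h, hg => ⟨h.1.trans (hg y (by simp)),
      h.2.mono fun z hz => hg z (List.mem_cons_of_mem _ hz)⟩

theorem Layered.sublist {g : N → ℕ} {l l' : List N} (hl : l'.Sublist l) (h : Layered g l) :
    Layered g l' := by
  induction hl with
  | slnil => exact h
  | cons a _ ih => exact ih h.2
  | cons_cons a hs ih => exact ⟨hs.length_le.trans h.1, ih h.2⟩

/-- An element with `k` elements after it contributes at least `fib (k + 1)`. Summing over all `k`
below the length gives the claim, since `fib 0 = 0` adds nothing. -/
theorem Layered.sum_fib_le {g f : N → ℕ} : ∀ {l : List N}, Layered g l →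
    (∀ y ∈ l, Nat.fib (g y + 1) ≤ f y) →
    ∑ k ∈ Finset.range (l.length + 1), Nat.fib k ≤ (l.map f).sum
  | [], _, _ => by simp
  | y :: l, h, hf => by
    have h1 := Layered.sum_fib_le h.2 fun z hz => hf z (List.mem_cons_of_mem _ hz)
    have h2 := hf y (by simp)
    have h3 : Nat.fib (l.length + 1) ≤ Nat.fib (g y + 1) := Nat.fib_mono (by have := h.1; omega)
    rw [List.length_cons, Finset.sum_range_succ, List.map_cons, List.sum_cons]
    omega

/-- Fibonacci numbers at least double every two steps. -/
theorem two_pow_half_le_fib : ∀ d : ℕ, 2 ^ (d / 2) ≤ Nat.fib (d + 2)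
  | 0 => by simp
  | 1 => by decide
  | d + 2 => by
    have h1 := two_pow_half_le_fib d
    have h2 : Nat.fib (d + 2 + 2) = Nat.fib (d + 2) + Nat.fib (d + 2 + 1) := Nat.fib_add_two
    have h3 : Nat.fib (d + 2) ≤ Nat.fib (d + 2 + 1) := Nat.fib_le_fib_succ
    have h4 : (d + 2) / 2 = d / 2 + 1 := by omega
    rw [h4, pow_succ]
    omega

/-- The pointers describe a heap-ordered forest on the set `H` of nodes, with each node `y`
having at most `g y` older siblings. -/
structure Forest (H : Finset N) (key : N → ℕ) (parent : N → Option N) (children : N → List N)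
    (degree : N → ℕ) (g : N → ℕ) : Prop where
  mem_children : ∀ x y, y ∈ children x ↔ parent y = some x
  nodup : ∀ x, (children x).Nodup
  degree_eq : ∀ x, degree x = (children x).length
  parent_mem : ∀ x y, parent y = some x → x ∈ H
  child_mem : ∀ x y, parent y = some x → y ∈ H
  key_le : ∀ x y, parent y = some x → key x ≤ key y
  rank : ∃ rank : N → ℕ, ∀ x y, parent y = some x → rank y < rank x
  layered : ∀ x, Layered g (children x)

namespace Forest
variable {H : Finset N} {key : N → ℕ} {parent : N → Option N} {children : N → List N}
  {degree g g' : N → ℕ}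

theorem congr_credit (h : Forest H key parent children degree g)
    (hg : ∀ y x, parent y = some x → g y ≤ g' y) : Forest H key parent children degree g' :=
  { h with layered := fun x => (h.layered x).mono fun y hy => hg y x ((h.mem_children x y).1 hy) }

theorem ne_of_parent (h : Forest H key parent children degree g) {x y : N}
    (hy : parent y = some x) : y ≠ x := by
  rintro rfl
  obtain ⟨r, hr⟩ := h.rank
  exact lt_irrefl _ (hr _ _ hy)

/-- Among the nodes with key at most `key y`, one of maximal rank has no parent: a parent would have
a key no larger and a greater rank. -/
theorem exists_root_le (h : Forest H key parent children degree g) {y : N} (hy : y ∈ H) :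
    ∃ x ∈ H, parent x = none ∧ key x ≤ key y := by
  obtain ⟨r, hr⟩ := h.rank
  obtain ⟨x, hx, hmax⟩ := Finset.exists_max_image (H.filter fun z => key z ≤ key y) r
    ⟨y, by simp [hy]⟩
  rw [Finset.mem_filter] at hx
  refine ⟨x, hx.1, ?_, hx.2⟩
  cases hp : parent x with
  | none => rfl
  | some p =>
    have h1 := hmax p (by
      rw [Finset.mem_filter]
      exact ⟨h.parent_mem _ _ hp, (h.key_le _ _ hp).trans hx.2⟩)
    have h2 := hr _ _ hp
    omega

theorem rank_le_of_reach {r : N → ℕ} (hr : ∀ x y, parent y = some x → r y < r x) {z x : N}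
    (h : Relation.ReflTransGen (fun z p => parent z = some p) z x) : r z ≤ r x := by
  induction h with
  | refl => exact le_rfl
  | tail _ hs ih => exact ih.trans (hr _ _ hs).le

-- Induction on the rank. The sets of descendants of different children are disjoint and do not
-- contain `x`. By the layering the children account for at least the sum of `fib k` over `k ≤
-- degree x`, and `x` itself supplies the summand 1 in the identity for `fib (degree x + 2)`.
open Classical in
theorem fib_le_card [Fintype N] (h : Forest H key parent children degree g)
    (hg : ∀ y, g y ≤ degree y + 1) (x : N) :
    Nat.fib (degree x + 2) ≤ (Finset.univ.filter fun z =>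
      Relation.ReflTransGen (fun z p => parent z = some p) z x).card := by
  obtain ⟨r, hr⟩ := h.rank
  induction hn : r x using Nat.strong_induction_on generalizing x with
  | _ n ih =>
  subst hn
  set D : N → Finset N := fun x => Finset.univ.filter fun z =>
      Relation.ReflTransGen (fun z p => parent z = some p) z x with hD
  have hmem : ∀ z x, z ∈ D x ↔ Relation.ReflTransGen (fun z p => parent z = some p) z x := by
    simp [hD]
  have hchild : ∀ y ∈ children x, Nat.fib (g y + 1) ≤ (D y).card := fun y hy =>
    (Nat.fib_mono (by have := hg y; omega)).trans
      (ih _ (hr _ _ ((h.mem_children x y).1 hy)) y rfl)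
  have hsum := (h.layered x).sum_fib_le hchild
  have hdisj : ∀ y₁ ∈ children x, ∀ y₂ ∈ children x, ∀ z, z ∈ D y₁ → z ∈ D y₂ → y₁ = y₂ := by
    -- A path from one child of `x` up to another one would pass through `x`, and then the rank of
    -- the second child would be at least that of `x`.
    have key : ∀ y₁ ∈ children x, ∀ y₂ ∈ children x,
        Relation.ReflTransGen (fun z p => parent z = some p) y₁ y₂ → y₁ = y₂ := by
      intro y₁ h₁ y₂ h₂ hreach
      rcases Relation.ReflTransGen.cases_head hreach with h' | ⟨p, hp, hp'⟩
      · exact h'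
      · rw [(h.mem_children x y₁).1 h₁] at hp
        cases hp
        have e1 := rank_le_of_reach hr hp'
        have e2 := hr _ _ ((h.mem_children x y₂).1 h₂)
        omega
    intro y₁ h₁ y₂ h₂ z hz₁ hz₂
    -- Parents are unique, so the ancestors of `z` form a chain; two children of `x` above `z` are
    -- therefore comparable.
    have hu : Relator.RightUnique fun z p : N => parent z = some p := fun a b c hb hc =>
      Option.some.inj (hb.symm.trans hc)
    rcases Relation.ReflTransGen.total_of_right_unique hu ((hmem _ _).1 hz₁) ((hmem _ _).1 hz₂)
      with h' | h'
    · exact key _ h₁ _ h₂ h'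
    · exact (key _ h₂ _ h₁ h').symm
  have hcard : ((children x).map fun y => (D y).card).sum =
      ((children x).toFinset.biUnion D).card := by
    rw [Finset.card_biUnion, List.sum_toFinset _ (h.nodup x)]
    intro y₁ h₁ y₂ h₂ hne
    exact Finset.disjoint_left.2 fun z hz₁ hz₂ => hne (hdisj _ (by simpa using h₁) _ (by simpa using h₂) z hz₁ hz₂)
  have hx : x ∉ (children x).toFinset.biUnion D := by
    simp only [Finset.mem_biUnion, List.mem_toFinset, not_exists, not_and]
    intro y hy hxy
    have e1 := rank_le_of_reach hr ((hmem _ _).1 hxy)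
    have e2 := hr _ _ ((h.mem_children x y).1 hy)
    omega
  have hsub : Insert.insert x ((children x).toFinset.biUnion D) ⊆ D x := by
    intro z hz
    rw [hmem]
    rcases Finset.mem_insert.1 hz with rfl | hz
    · exact .refl
    · simp only [Finset.mem_biUnion, List.mem_toFinset] at hz
      obtain ⟨y, hy, hzy⟩ := hz
      exact ((hmem _ _).1 hzy).tail ((h.mem_children x y).1 hy)
  have h1 := Finset.card_le_card hsub
  rw [Finset.card_insert_of_notMem hx, ← hcard] at h1
  rw [show degree x + 2 = (children x).length + 1 + 1 by rw [h.degree_eq],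
    Nat.fib_succ_eq_succ_sum]
  change _ ≤ (D x).card
  omega

theorem degree_le [Fintype N] (h : Forest H key parent children degree g)
    (hg : ∀ y, g y ≤ degree y + 1) (x : N) :
    degree x ≤ 2 * Nat.log 2 (Fintype.card N) + 1 := by
  classical
  have h1 := (two_pow_half_le_fib (degree x)).trans
    ((h.fib_le_card hg x).trans (Finset.card_le_univ _))
  have h2 := Nat.le_log_of_pow_le Nat.one_lt_two h1
  omega

theorem parent_eq_none (h : Forest H key parent children degree g) {x : N} (hx : x ∉ H) :
    parent x = none := by
  cases hp : parent x with
  | none => rfl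
  | some p => exact absurd (h.child_mem _ _ hp) hx

theorem children_eq_nil (h : Forest H key parent children degree g) {x : N} (hx : x ∉ H) :
    children x = [] :=
  List.eq_nil_iff_forall_not_mem.2 fun y hy =>
    hx (h.parent_mem _ _ ((h.mem_children x y).1 hy))

theorem degree_eq_zero (h : Forest H key parent children degree g) {x : N} (hx : x ∉ H) :
    degree x = 0 := by
  rw [h.degree_eq, h.children_eq_nil hx, List.length_nil]

variable [DecidableEq N]

/-- All former children of `x` become older siblings of `y`. Their number is `degree x`, which
equals `degree y`; this is why linking only trees of equal degree preserves the layering. -/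
theorem link (h : Forest H key parent children degree g) {x y : N} (hx : x ∈ H) (hy : y ∈ H)
    (hxy : y ≠ x) (hpx : parent x = none) (hpy : parent y = none) (hk : key x ≤ key y)
    (hd : degree x = degree y) (hg : ∀ z, z ≠ y → g z ≤ g' z) (hgy : degree y ≤ g' y) :
    Forest H key (Function.update parent y (some x))
      (Function.update children x (y :: children x))
      (Function.update degree x (degree x + 1)) g' where
  mem_children u v := by
    by_cases hu : u = x <;> by_cases hv : v = y
    · subst hu hv; simp
    · subst hu; simp [hv, h.mem_children]
    · subst hv; simp [hu, h.mem_children, hpy, Ne.symm hu]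
    · simp [hu, hv, h.mem_children]
  nodup u := by
    by_cases hu : u = x
    · subst hu; simp [h.nodup, h.mem_children, hpy]
    · simp [hu, h.nodup]
  degree_eq u := by
    by_cases hu : u = x
    · subst hu; simp [h.degree_eq]
    · simp [hu, h.degree_eq]
  parent_mem u v huv := by
    by_cases hv : v = y
    · subst hv; simp at huv; exact huv ▸ hx
    · exact h.parent_mem u v (by simpa [hv] using huv)
  child_mem u v huv := by
    by_cases hv : v = y
    · exact hv ▸ hy
    · exact h.child_mem u v (by simpa [hv] using huv)
  key_le u v huv := by
    by_cases hv : v = y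
    · subst hv; simp at huv; exact huv ▸ hk
    · exact h.key_le u v (by simpa [hv] using huv)
  rank := by
    obtain ⟨r, hr⟩ := h.rank
    -- As `x` is a root, nothing bounds its rank from above, so it may be raised beyond the rank of
    -- `y`.
    refine ⟨Function.update r x (r x + r y + 1), fun u v huv => ?_⟩
    by_cases hv : v = y
    · subst hv
      simp at huv
      subst huv
      simp only [Function.update_self, Function.update_of_ne hxy]
      omega
    · rw [Function.update_of_ne hv] at huv
      have hvx : v ≠ x := by
        rintro rfl
        rw [hpx] at huv
        cases huv
      have := hr _ _ huv
      by_cases hu : u = x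
      · subst hu; simp [hvx]; omega
      · simpa [hvx, hu] using this
  layered u := by
    have key : ∀ u, Layered g' (children u) := fun u => (h.layered u).mono fun z hz => hg z (by
      rintro rfl
      rw [h.mem_children, hpy] at hz
      cases hz)
    by_cases hu : u = x
    · subst hu
      simp only [Function.update_self]
      exact ⟨by rw [← h.degree_eq, hd]; exact hgy, key u⟩
    · simpa [hu] using key u

/-- The remaining siblings of `x` have no more older siblings than before. The loss is in the degree
of `y`; the callers compensate it by a bound `g'` that exceeds the new credit of `y` by one. -/
theorem cut (h : Forest H key parent children degree g) {x y : N} (hxy : parent x = some y)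
    (hg : ∀ z p, z ≠ x → parent z = some p → g z ≤ g' z) :
    Forest H key (Function.update parent x none)
      (Function.update children y ((children y).erase x))
      (Function.update degree y (degree y - 1)) g' where
  mem_children u v := by
    by_cases hu : u = y <;> by_cases hv : v = x
    · subst hu hv; simp [(h.nodup u).mem_erase_iff]
    · subst hu; simp [hv, h.mem_children, (h.nodup u).mem_erase_iff]
    · subst hv; simp [hu, h.mem_children, hxy, Ne.symm hu]
    · simp [hu, hv, h.mem_children]
  nodup u := by
    by_cases hu : u = y
    · subst hu; simpa using (h.nodup u).erase x
    · simp [hu, h.nodup]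
  degree_eq u := by
    by_cases hu : u = y
    · subst hu
      simp [h.degree_eq, List.length_erase_of_mem ((h.mem_children u x).2 hxy)]
    · simp [hu, h.degree_eq]
  parent_mem u v huv := by
    by_cases hv : v = x
    · subst hv; simp at huv
    · exact h.parent_mem u v (by simpa [hv] using huv)
  child_mem u v huv := by
    by_cases hv : v = x
    · subst hv; simp at huv
    · exact h.child_mem u v (by simpa [hv] using huv)
  key_le u v huv := by
    by_cases hv : v = x
    · subst hv; simp at huv
    · exact h.key_le u v (by simpa [hv] using huv)
  rank := by
    obtain ⟨r, hr⟩ := h.rank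
    refine ⟨r, fun u v huv => ?_⟩
    by_cases hv : v = x
    · subst hv; simp at huv
    · exact hr u v (by simpa [hv] using huv)
  layered u := by
    by_cases hu : u = y
    · subst hu
      rw [Function.update_self]
      exact ((h.layered u).sublist List.erase_sublist).mono fun z hz => by
        rw [(h.nodup u).mem_erase_iff] at hz
        exact hg z u hz.1 ((h.mem_children u z).1 hz.2)
    · rw [Function.update_of_ne hu]
      refine (h.layered u).mono fun z hz => ?_
      rw [h.mem_children] at hz
      refine hg z u ?_ hz
      rintro rfl
      rw [hxy] at hz
      exact hu (Option.some.inj hz).symm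

theorem update_key (h : Forest H key parent children degree g) {x : N} {k : ℕ}
    (hk : k ≤ key x) (hp : ∀ y, parent x = some y → key y ≤ k) :
    Forest H (Function.update key x k) parent children degree g :=
  { h with
    key_le := fun u v huv => by
      have h1 := h.key_le u v huv
      by_cases hv : v = x
      · subst hv
        have hu : u ≠ v := (h.ne_of_parent huv).symm
        simpa [hu] using hp u huv
      · by_cases hu : u = x
        · subst hu
          simpa [hv] using hk.trans h1
        · simpa [hu, hv] using h1 }

theorem insert (h : Forest H key parent children degree g) {x : N} (k : ℕ) (hx : x ∉ H)
    (hg : ∀ z, z ≠ x → g z ≤ g' z) :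
    Forest (Insert.insert x H) (Function.update key x k) parent children degree g' :=
  { h with
    parent_mem := fun u v huv => Finset.mem_insert_of_mem (h.parent_mem u v huv)
    child_mem := fun u v huv => Finset.mem_insert_of_mem (h.child_mem u v huv)
    key_le := fun u v huv => by
      have h1 := h.parent_mem u v huv
      have h2 := h.child_mem u v huv
      have hu : u ≠ x := fun e => hx (e ▸ h1)
      have hv : v ≠ x := fun e => hx (e ▸ h2)
      simpa [hu, hv] using h.key_le u v huv
    layered := fun u => (h.layered u).mono fun z hz => hg z fun e =>
      hx (e ▸ h.child_mem u z ((h.mem_children u z).1 hz)) }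

theorem extract (h : Forest H key parent children degree g) {x : N} (hx : parent x = none)
    (hg : ∀ z, z ≠ x → g z ≤ g' z) :
    Forest (H.erase x) key (fun y => if y ∈ children x then none else parent y)
      (Function.update children x []) (Function.update degree x 0) g' := by
  have hp : ∀ {u v : N}, (if v ∈ children x then none else parent v) = some u →
      u ≠ x ∧ v ≠ x ∧ parent v = some u := by
    intro u v huv
    split_ifs at huv with hv
    refine ⟨?_, ?_, huv⟩
    · rintro rfl
      exact hv ((h.mem_children _ _).2 huv)
    · rintro rfl
      rw [hx] at huv
      cases huv
  refine
  { mem_children := fun u v => ?_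
    nodup := fun u => ?_
    degree_eq := fun u => ?_
    parent_mem := fun u v huv =>
      Finset.mem_erase.2 ⟨(hp huv).1, h.parent_mem _ _ (hp huv).2.2⟩
    child_mem := fun u v huv =>
      Finset.mem_erase.2 ⟨(hp huv).2.1, h.child_mem _ _ (hp huv).2.2⟩
    key_le := fun u v huv => h.key_le _ _ (hp huv).2.2
    rank := by
      obtain ⟨r, hr⟩ := h.rank
      exact ⟨r, fun u v huv => hr _ _ (hp huv).2.2⟩
    layered := fun u => ?_ }
  · by_cases hu : u = x
    · subst hu
      simp [h.mem_children]
    · simp only [Function.update_of_ne hu, h.mem_children]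
      constructor
      · intro huv
        rw [if_neg]
        · exact huv
        · intro hv
          rw [huv] at hv
          exact hu (Option.some.inj hv)
      · intro huv
        split_ifs at huv
        exact huv
  · by_cases hu : u = x
    · subst hu; simp
    · simp [hu, h.nodup]
  · by_cases hu : u = x
    · subst hu; simp
    · simp [hu, h.degree_eq]
  · by_cases hu : u = x
    · subst hu; simp [Layered]
    · rw [Function.update_of_ne hu]
      refine (h.layered u).mono fun z hz => hg z ?_
      rintro rfl
      rw [h.mem_children, hx] at hz
      cases hz

end Forest
end forest
-- Potential, heap invariants, and insertion.
section heap
variable {N T : Type} [Fintype N] [DecidableEq N]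

/-- The number of older siblings that a node may have. -/
def credit (s : Mem N T) (y : N) : ℕ := s.degree y + (s.mark y).toNat

omit [Fintype N] [DecidableEq N] in
theorem credit_le (s : Mem N T) (y : N) : credit s y ≤ s.degree y + 1 := by
  have := Bool.toNat_le (s.mark y)
  unfold credit
  omega

/-- The number of trees. -/
def tops (parent : N → Option N) (H : Finset N) : ℕ := (H.filter fun x => parent x = none).card

/-- The number of marked nodes. -/
def marks (mark : N → Bool) : ℕ := (Finset.univ.filter fun x => mark x = true).card

omit [Fintype N] in
theorem tops_link {parent : N → Option N} {H : Finset N} {y : N} (x : N) (hy : y ∈ H)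
    (hp : parent y = none) : tops (Function.update parent y (some x)) H + 1 = tops parent H := by
  have : (H.filter fun z => Function.update parent y (some x) z = none) =
      (H.filter fun z => parent z = none).erase y := by
    ext z
    by_cases hz : z = y
    · subst hz; simp
    · simp [hz]
  rw [tops, tops, this]
  exact Finset.card_erase_add_one (by simp [hy, hp])

omit [Fintype N] in
theorem tops_cut_le (parent : N → Option N) (H : Finset N) (x : N) :
    tops (Function.update parent x none) H ≤ tops parent H + 1 := by
  have : (H.filter fun z => Function.update parent x none z = none) ⊆
      Insert.insert x (H.filter fun z => parent z = none) := by
    intro z hz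
    by_cases hzx : z = x
    · simp [hzx]
    · simpa [hzx] using hz
  exact (Finset.card_le_card this).trans (Finset.card_insert_le _ _)

omit [Fintype N] in
theorem tops_insert_le (parent : N → Option N) (H : Finset N) (x : N) :
    tops parent (Insert.insert x H) ≤ tops parent H + 1 := by
  have : ((Insert.insert x H).filter fun z => parent z = none) ⊆
      Insert.insert x (H.filter fun z => parent z = none) := by
    intro z hz
    by_cases hzx : z = x
    · simp [hzx]
    · simpa [hzx] using hz
  exact (Finset.card_le_card this).trans (Finset.card_insert_le _ _)

theorem marks_unmark_le (mark : N → Bool) (x : N) :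
    marks (Function.update mark x false) ≤ marks mark := by
  refine Finset.card_le_card fun z hz => ?_
  by_cases hzx : z = x
  · simp [hzx] at hz
  · simpa [hzx] using hz

theorem marks_unmark {mark : N → Bool} {x : N} (hx : mark x = true) :
    marks (Function.update mark x false) + 1 = marks mark := by
  have : (Finset.univ.filter fun z => Function.update mark x false z = true) =
      (Finset.univ.filter fun z => mark z = true).erase x := by
    ext z
    by_cases hz : z = x
    · subst hz; simp
    · simp [hz]
  rw [marks, marks, this]
  exact Finset.card_erase_add_one (by simp [hx])

theorem marks_mark_le (mark : N → Bool) (x : N) :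
    marks (Function.update mark x true) ≤ marks mark + 1 := by
  have : (Finset.univ.filter fun z => Function.update mark x true z = true) ⊆
      Insert.insert x (Finset.univ.filter fun z => mark z = true) := by
    intro z hz
    by_cases hzx : z = x
    · simp [hzx]
    · simpa [hzx] using hz
  exact (Finset.card_le_card this).trans (Finset.card_insert_le _ _)

/-- The part of the memory that the heap does not use is the same. -/
structure Frame (s s' : Mem N T) : Prop where
  cost : s'.cost = s.cost
  chosen : s'.chosen = s.chosen
  withFirst : s'.withFirst = s.withFirst
  withSecond : s'.withSecond = s.withSecond

omit [Fintype N] [DecidableEq N] in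
theorem Frame.trans {s s' s'' : Mem N T} (h : Frame s s') (h' : Frame s' s'') : Frame s s'' :=
  ⟨h'.1.trans h.1, h'.2.trans h.2, h'.3.trans h.3, h'.4.trans h.4⟩

/-- The memory holds a heap with the set `H` of nodes, up to the pointer to the minimum. -/
structure Shape (s : Mem N T) (H : Finset N) (g : N → ℕ) : Prop where
  forest : Forest H s.key s.parent s.children s.degree g
  roots_nodup : s.roots.Nodup
  mem_roots : ∀ x, x ∈ s.roots ↔ x ∈ H ∧ s.parent x = none
  slot_none : ∀ d, s.slot d = none
  top_eq : s.top = 0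
  key_size : ∀ x, (s.key x).size ≤ Fintype.card N + 1

/-- The memory holds a heap with the set `H` of nodes. -/
structure Heap (s : Mem N T) (H : Finset N) : Prop extends Shape s H (credit s) where
  min_none : s.minRoot = none → H = ∅
  min_mem : ∀ m, s.minRoot = some m → m ∈ s.roots
  min_le : ∀ m, s.minRoot = some m → ∀ y ∈ H, s.key m ≤ s.key y

/-- The pointer to the minimum is right for the list of roots. -/
structure RootMin (s : Mem N T) : Prop where
  none_iff : s.minRoot = none → s.roots = []
  mem : ∀ m, s.minRoot = some m → m ∈ s.roots
  le : ∀ m, s.minRoot = some m → ∀ y ∈ s.roots, s.key m ≤ s.key y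

/-- The unit of the amortized running time: a bound for the time of constantly many operations
on integers that occur as costs. -/
def unit (N : Type) [Fintype N] : ℕ := 20 * (Fintype.card N + 1)

/-- The potential of the heap. -/
def energy (s : Mem N T) (H : Finset N) : ℕ :=
  unit N * (3 * tops s.parent H + 4 * marks s.mark)

theorem Shape.tops_eq {s : Mem N T} {H : Finset N} {g : N → ℕ} (h : Shape s H g) :
    tops s.parent H = s.roots.length := by
  rw [tops, ← List.toFinset_card_of_nodup h.roots_nodup]
  congr 1
  ext x
  simp [h.mem_roots]

omit [DecidableEq N] in
theorem Heap.rootMin {s : Mem N T} {H : Finset N} (h : Heap s H) : RootMin s where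
  none_iff hm := List.eq_nil_iff_forall_not_mem.2 fun x hx => by
    have := ((h.mem_roots x).1 hx).1
    rw [h.min_none hm] at this
    simp at this
  mem := h.min_mem
  le m hm y hy := h.min_le m hm y ((h.mem_roots y).1 hy).1

-- Each node is bounded below by a root, so a minimum over the roots is a minimum over the whole
-- heap, and a heap without roots is empty.
omit [DecidableEq N] in
theorem Shape.heap {s : Mem N T} {H : Finset N} (h : Shape s H (credit s)) (hm : RootMin s) :
    Heap s H where
  toShape := h
  min_none hn := Finset.eq_empty_of_forall_notMem fun y hy => by
    obtain ⟨x, hx, hp, -⟩ := h.forest.exists_root_le hy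
    have := (h.mem_roots x).2 ⟨hx, hp⟩
    rw [hm.none_iff hn] at this
    simp at this
  min_mem := hm.mem
  min_le m hs y hy := by
    obtain ⟨x, hx, hp, hxy⟩ := h.forest.exists_root_le hy
    exact (hm.le m hs x ((h.mem_roots x).2 ⟨hx, hp⟩)).trans hxy

-- Six operations at most, with two integers read and then compared; hence four times the bit bound.
omit [DecidableEq N] in
theorem addRoot_spec {s : Mem N T} (x : N) (h : RootMin s)
    (hk : ∀ y, (s.key y).size ≤ Fintype.card N + 1) :
    wp (addRoot x) (fun _ s' => ∃ c m, c ≤ 6 + 4 * (Fintype.card N + 1) ∧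
      s' = { s with clock := s.clock + c, roots := x :: s.roots, minRoot := m } ∧
      RootMin s') s := by
  simp only [addRoot, wp_bind, wp_wr, wp_rd]
  cases hm : s.minRoot with
  | none =>
    simp only [wp_wr]
    refine ⟨3, some x, by omega, rfl, ⟨?_, ?_, ?_⟩⟩ <;> simp [h.none_iff hm]
  | some m =>
    have h1 := hk x
    have h2 := hk m
    have h3 := h.mem m hm
    have h4 := h.le m hm
    simp only [wp_bind, wp_rdInt, wp_less, wp_ite, wp_wr, wp_pure, decide_eq_true_eq]
    split_ifs with hlt
    · refine ⟨_, _, ?_, by simp only [add_assoc]; rfl, ⟨?_, ?_, ?_⟩⟩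
      · omega
      · simp
      · simp
      · simp only [Option.some.injEq, List.mem_cons]
        rintro _ rfl y (rfl | hy)
        · exact le_rfl
        · exact hlt.le.trans (h4 y hy)
    · refine ⟨_, some m, ?_, by simp only [add_assoc]; rfl, ⟨?_, ?_, ?_⟩⟩
      · omega
      · simp
      · simp [h3]
      · simp only [Option.some.injEq, List.mem_cons]
        rintro _ rfl y (rfl | hy)
        · exact not_lt.1 hlt
        · exact h4 y hy

theorem insert_spec {s : Mem N T} {H : Finset N} (h : Heap s H) {x : N} {k : ℕ} (hx : x ∉ H)
    (hk : k.size ≤ Fintype.card N + 1) :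
    wp (insert x k) (fun _ s' => Heap s' (Insert.insert x H) ∧
      s'.key = Function.update s.key x k ∧ Frame s s' ∧
      s'.clock + energy s' (Insert.insert x H) ≤ s.clock + energy s H + 4 * unit N) s := by
  have hp := h.forest.parent_eq_none hx
  have hc := h.forest.children_eq_nil hx
  have hd := h.forest.degree_eq_zero hx
  have hxr : x ∉ s.roots := fun hxr => hx ((h.mem_roots x).1 hxr).1
  simp only [insert, wp_bind, wp_wrInt, wp_wr]
  -- A node outside the heap has no parent, no children and degree 0, so these writes change
  -- nothing. Only its mark may have to be reset.
  rw [show Function.update s.parent x none = s.parent from Function.update_eq_self_iff.2 hp.symm,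
    show Function.update s.children x [] = s.children from Function.update_eq_self_iff.2 hc.symm,
    show Function.update s.degree x 0 = s.degree from Function.update_eq_self_iff.2 hd.symm]
  have hks : ∀ y, (Function.update s.key x k y).size ≤ Fintype.card N + 1 := fun y => by
    by_cases hy : y = x
    · subst hy; simpa using hk
    · simpa [hy] using h.key_size y
  refine wp_mono (addRoot_spec x ⟨h.rootMin.none_iff, h.rootMin.mem, ?_⟩ hks) ?_
  · intro m hm y hy
    have hmx : m ≠ x := fun e => hxr (e ▸ h.min_mem m hm)
    have hyx : y ≠ x := fun e => hxr (e ▸ hy)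
    simpa [hmx, hyx] using h.rootMin.le m hm y hy
  · rintro - s' ⟨c, m, hc, rfl, hmin⟩
    refine ⟨Shape.heap ⟨?_, ?_, ?_, h.slot_none, h.top_eq, hks⟩ hmin, rfl,
      ⟨rfl, rfl, rfl, rfl⟩, ?_⟩
    · refine h.forest.insert k hx fun z hz => ?_
      simp [credit, hz]
    · exact List.nodup_cons.2 ⟨hxr, h.roots_nodup⟩
    · intro y
      simp only [List.mem_cons, h.mem_roots, Finset.mem_insert]
      constructor
      · rintro (rfl | ⟨h1, h2⟩)
        · exact ⟨.inl rfl, hp⟩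
        · exact ⟨.inr h1, h2⟩
      · rintro ⟨rfl | h1, h2⟩
        · exact .inl rfl
        · exact .inr ⟨h1, h2⟩
    · have e1 := tops_insert_le s.parent H x
      have e2 := marks_unmark_le s.mark x
      have e3 : unit N * (3 * tops s.parent (Insert.insert x H) +
          4 * marks (Function.update s.mark x false)) ≤
          unit N * (3 * tops s.parent H + 4 * marks s.mark + 3) :=
        Nat.mul_le_mul_left _ (by omega)
      simp only [energy]
      have e4 : unit N = 20 * (Fintype.card N + 1) := rfl
      rw [mul_add _ _ 3] at e3
      omega

end heap
-- Consolidation of the heap.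
section heap
variable {N T : Type} [Fintype N] [DecidableEq N]

/-- A bound for the number of different degrees in a heap. -/
def degrees (N : Type) [Fintype N] : ℕ := 2 * Nat.log 2 (Fintype.card N) + 2

/-- During the consolidation, the roots are the elements of the list `W` and the nodes that
the auxiliary array holds. -/
structure Placing (s : Mem N T) (H : Finset N) (W : List N) : Prop where
  forest : Forest H s.key s.parent s.children s.degree (credit s)
  pending_mem : ∀ w ∈ W, w ∈ H
  pending_root : ∀ w ∈ W, s.parent w = none
  pending_nodup : W.Nodup
  slot_degree : ∀ d x, s.slot d = some x → s.degree x = d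
  slot_mem : ∀ d x, s.slot d = some x → x ∈ H
  slot_root : ∀ d x, s.slot d = some x → s.parent x = none
  slot_lt : ∀ d x, s.slot d = some x → d < s.top
  cover : ∀ x ∈ H, s.parent x = none → x ∈ W ∨ s.slot (s.degree x) = some x
  disjoint : ∀ w ∈ W, s.slot (s.degree w) ≠ some w
  top_le : s.top ≤ degrees N
  key_size : ∀ x, (s.key x).size ≤ Fintype.card N + 1

omit [DecidableEq N] in
theorem Placing.perm {s : Mem N T} {H : Finset N} {W W' : List N} (h : Placing s H W)
    (hW : W.Perm W') : Placing s H W' :=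
  { h with
    pending_mem := fun w hw => h.pending_mem w (hW.mem_iff.2 hw)
    pending_root := fun w hw => h.pending_root w (hW.mem_iff.2 hw)
    pending_nodup := hW.nodup_iff.1 h.pending_nodup
    cover := fun x hx hp => by rw [← hW.mem_iff]; exact h.cover x hx hp
    disjoint := fun w hw => h.disjoint w (hW.mem_iff.2 hw) }

omit [DecidableEq N] in
theorem Placing.clock {s : Mem N T} {H : Finset N} {W : List N} (h : Placing s H W) (c : ℕ) :
    Placing { s with clock := c } H W :=
  ⟨h.1, h.2, h.3, h.4, h.5, h.6, h.7, h.8, h.9, h.10, h.11, h.12⟩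

omit [DecidableEq N] in
theorem Placing.fill {s : Mem N T} {H : Finset N} {x : N} {W : List N}
    (h : Placing s H (x :: W)) (hs : s.slot (s.degree x) = none) (c : ℕ) :
    Placing { s with
      clock := c
      slot := Function.update s.slot (s.degree x) (some x)
      top := max s.top (s.degree x + 1) } H W := by
  have hsome : ∀ d y, Function.update s.slot (s.degree x) (some x) d = some y →
      (d = s.degree x ∧ y = x) ∨ s.slot d = some y := by
    intro d y hd
    by_cases hdx : d = s.degree x
    · subst hdx
      simp only [Function.update_self, Option.some.injEq] at hd
      exact .inl ⟨rfl, hd.symm⟩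
    · exact .inr (by simpa [hdx] using hd)
  refine ⟨h.forest, fun w hw => h.pending_mem w (by simp [hw]),
    fun w hw => h.pending_root w (by simp [hw]), (List.nodup_cons.1 h.pending_nodup).2,
    ?_, ?_, ?_, ?_, ?_, ?_, ?_, h.key_size⟩
  · intro d y hd
    rcases hsome d y hd with ⟨rfl, rfl⟩ | hd
    · rfl
    · exact h.slot_degree _ _ hd
  · intro d y hd
    rcases hsome d y hd with ⟨rfl, rfl⟩ | hd
    · exact h.pending_mem _ (by simp)
    · exact h.slot_mem _ _ hd
  · intro d y hd
    rcases hsome d y hd with ⟨rfl, rfl⟩ | hd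
    · exact h.pending_root _ (by simp)
    · exact h.slot_root _ _ hd
  · intro d y hd
    rcases hsome d y hd with ⟨rfl, rfl⟩ | hd
    · exact lt_max_of_lt_right (Nat.lt_succ_self _)
    · exact lt_max_of_lt_left (h.slot_lt _ _ hd)
  · intro y hy hp
    rcases h.cover y hy hp with hw | hw
    · rcases List.mem_cons.1 hw with rfl | hw
      · exact .inr (by simp)
      · exact .inl hw
    · refine .inr ?_
      have : s.degree y ≠ s.degree x := fun e => by rw [e, hs] at hw; cases hw
      simpa [this] using hw
  · intro w hw hd
    rcases hsome _ _ hd with ⟨-, rfl⟩ | hd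
    · exact (List.nodup_cons.1 h.pending_nodup).1 hw
    · exact h.disjoint w (by simp [hw]) hd
  · refine max_le h.top_le ?_
    have := h.forest.degree_le (credit_le s) x
    unfold degrees
    omega

omit [DecidableEq N] in
theorem Placing.clear {s : Mem N T} {H : Finset N} {y : N} {W : List N} (h : Placing s H W)
    {d : ℕ} (hs : s.slot d = some y) (c : ℕ) :
    Placing { s with clock := c, slot := Function.update s.slot d none } H (y :: W) := by
  have hsome : ∀ e x, Function.update s.slot d none e = some x → e ≠ d ∧ s.slot e = some x := by
    intro e x he
    by_cases hed : e = d
    · subst hed; simp at he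
    · exact ⟨hed, by simpa [hed] using he⟩
  have hd := h.slot_degree d y hs
  refine ⟨h.forest, ?_, ?_, ?_, fun e x he => h.slot_degree _ _ (hsome e x he).2,
    fun e x he => h.slot_mem _ _ (hsome e x he).2, fun e x he => h.slot_root _ _ (hsome e x he).2,
    fun e x he => h.slot_lt _ _ (hsome e x he).2, ?_, ?_, h.top_le, h.key_size⟩
  · simpa using ⟨h.slot_mem _ _ hs, h.pending_mem⟩
  · simpa using ⟨h.slot_root _ _ hs, h.pending_root⟩
  · refine List.nodup_cons.2 ⟨fun hy => h.disjoint y hy ?_, h.pending_nodup⟩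
    rw [hd, hs]
  · intro x hx hp
    rcases h.cover x hx hp with hw | hw
    · exact .inl (List.mem_cons_of_mem _ hw)
    · by_cases hxd : s.degree x = d
      · rw [hxd, hs] at hw
        cases hw
        exact .inl (by simp)
      · exact .inr (by simpa [hxd] using hw)
  · intro w hw he
    have he := hsome _ _ he
    rcases List.mem_cons.1 hw with rfl | hw
    · exact he.1 hd
    · exact h.disjoint w hw he.2

theorem Placing.link {s : Mem N T} {H : Finset N} {x y : N} {W : List N}
    (h : Placing s H (y :: x :: W)) (hk : s.key x ≤ s.key y) (hd : s.degree x = s.degree y)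
    (c : ℕ) :
    Placing { s with
      clock := c
      children := Function.update s.children x (y :: s.children x)
      degree := Function.update s.degree x (s.degree x + 1)
      parent := Function.update s.parent y (some x)
      mark := Function.update s.mark y false } H (x :: W) := by
  have hn := h.pending_nodup
  simp only [List.nodup_cons, List.mem_cons, not_or] at hn
  obtain ⟨⟨hyx, hyW⟩, hxW, hW⟩ := hn
  -- The array holds neither `x` nor `y`, as both are pending. Hence neither the new degree of `x`
  -- nor the new parent of `y` spoils a slot.
  have hslot : ∀ d z, s.slot d = some z → z ≠ x ∧ z ≠ y := by
    intro d z hz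
    have hdz := h.slot_degree d z hz
    constructor
    · rintro rfl
      exact h.disjoint z (by simp) (hdz ▸ hz)
    · rintro rfl
      exact h.disjoint z (by simp) (hdz ▸ hz)
  have hpx := h.pending_root x (by simp)
  have hpy := h.pending_root y (by simp)
  refine ⟨?_, fun w hw => h.pending_mem w (List.mem_cons_of_mem _ hw), ?_,
    (List.nodup_cons.1 h.pending_nodup).2, ?_, h.slot_mem, ?_, h.slot_lt, ?_, ?_, h.top_le,
    h.key_size⟩
  · refine h.forest.link (h.pending_mem x (by simp)) (h.pending_mem y (by simp)) hyx hpx hpy hk hd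
      ?_ ?_
    · intro z hz
      by_cases hzx : z = x
      · subst hzx; simp [credit, hz]
      · simp [credit, hz, hzx]
    · simp [credit, hyx]
  · intro w hw
    have hwy : w ≠ y := by
      rintro rfl
      rcases List.mem_cons.1 hw with rfl | hw
      · exact hyx rfl
      · exact hyW hw
    simpa [hwy] using h.pending_root w (List.mem_cons_of_mem _ hw)
  · intro d z hz
    simpa [(hslot d z hz).1] using h.slot_degree d z hz
  · intro d z hz
    simpa [(hslot d z hz).2] using h.slot_root d z hz
  · intro z hz hp
    have hzy : z ≠ y := by
      rintro rfl
      simp at hp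
    by_cases hzx : z = x
    · exact .inl (by simp [hzx])
    · rcases h.cover z hz (by simpa [hzy] using hp) with hw | hw
      · exact .inl (by simpa [hzy] using hw)
      · exact .inr (by simpa [hzx] using hw)
  · intro w hw hs
    by_cases hwx : w = x
    · exact (hslot _ _ hs).1 hwx
    · exact h.disjoint w (List.mem_cons_of_mem _ hw) (by simpa [hwx] using hs)

/-- What the consolidation leaves unchanged. -/
structure Placed (s s' : Mem N T) : Prop extends Frame s s' where
  key : s'.key = s.key
  roots : s'.roots = s.roots
  minRoot : s'.minRoot = s.minRoot
  marks : marks s'.mark ≤ marks s.mark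

omit [DecidableEq N] in
theorem Placed.trans {s s' s'' : Mem N T} (h : Placed s s') (h' : Placed s' s'') : Placed s s'' :=
  ⟨h.toFrame.trans h'.toFrame, h'.2.trans h.2, h'.3.trans h.3, h'.4.trans h.4, h'.5.trans h.5⟩

omit [Fintype N] in
theorem wp_link (y x : N) (Q : Unit → Mem N T → Prop) (s : Mem N T) :
    wp (link y x) Q s ↔ Q () { s with
      clock := s.clock + 4
      children := Function.update s.children x (y :: s.children x)
      degree := Function.update s.degree x (s.degree x + 1)
      parent := Function.update s.parent y (some x)
      mark := Function.update s.mark y false } := by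
  simp only [link, wp_bind, wp_wr]

/-- Every round that continues links two trees. The loss of a root pays for the round and serves as
the decreasing measure; the extra unit pays for the final round, which fills a slot. -/
theorem place_spec {s : Mem N T} {H : Finset N} {x : N} {W : List N}
    (h : Placing s H (x :: W)) :
    wp (place x) (fun _ s' => Placing s' H W ∧ Placed s s' ∧
      s'.clock + unit N * tops s'.parent H ≤ s.clock + unit N * tops s.parent H + unit N) s := by
  refine wp_loop (fun x t => Placing t H (x :: W) ∧ Placed s t ∧
      t.clock + unit N * tops t.parent H ≤ s.clock + unit N * tops s.parent H)
    (fun _ t => tops t.parent H) ?_ x s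
    ⟨h, ⟨⟨rfl, rfl, rfl, rfl⟩, rfl, rfl, rfl, le_rfl⟩, le_rfl⟩
  rintro x t ⟨ht, hst, hc⟩
  have hunit : unit N = 20 * (Fintype.card N + 1) := rfl
  simp only [wp_bind, wp_rd]
  cases hslot : t.slot (t.degree x) with
  | none =>
    simp only [wp_bind, wp_wr, wp_pure]
    refine ⟨ht.fill hslot _, hst.trans ⟨⟨rfl, rfl, rfl, rfl⟩, rfl, rfl, rfl, le_rfl⟩, ?_⟩
    omega
  | some y =>
    have hdy := ht.slot_degree _ _ hslot
    have hkx := ht.key_size x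
    have hky := ht.key_size y
    have hroot : ∀ z ∈ y :: x :: W, z ∈ H ∧ t.parent z = none := by
      intro z hz
      rcases List.mem_cons.1 hz with rfl | hz
      · exact ⟨ht.slot_mem _ _ hslot, ht.slot_root _ _ hslot⟩
      · exact ⟨ht.pending_mem z hz, ht.pending_root z hz⟩
    have htops : ∀ v ∈ y :: x :: W, ∀ u,
        tops (Function.update t.parent v (some u)) H + 1 = tops t.parent H := fun v hv u =>
      tops_link u (hroot v hv).1 (hroot v hv).2
    simp only [wp_bind, wp_rdInt, wp_less, wp_ite, wp_wr, wp_pure, wp_link, decide_eq_true_eq]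
    split_ifs with hlt
    · have h1 := htops x (by simp) y
      refine ⟨⟨((ht.clear hslot 0).perm (.swap _ _ _)).link (x := y) (y := x) hlt.le hdy _,
        hst.trans ⟨⟨rfl, rfl, rfl, rfl⟩, rfl, rfl, rfl, marks_unmark_le _ _⟩, ?_⟩, ?_⟩
      · rw [← h1, mul_add, mul_one] at hc
        omega
      · omega
    · have h1 := htops y (by simp) x
      refine ⟨⟨(ht.clear hslot 0).link (x := x) (y := y) (not_lt.1 hlt) hdy.symm _,
        hst.trans ⟨⟨rfl, rfl, rfl, rfl⟩, rfl, rfl, rfl, marks_unmark_le _ _⟩, ?_⟩, ?_⟩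
      · rw [← h1, mul_add, mul_one] at hc
        omega
      · omega

/-- The three units of potential of each old root pay for linking, for the final round of its
placement and for traversing the list. The `5 * degrees N` units cover the new roots and the pass
over the array. -/
theorem consolidate_spec {s : Mem N T} {H : Finset N} (h : Shape s H (credit s)) :
    wp consolidate (fun _ s' => Heap s' H ∧ s'.key = s.key ∧ Frame s s' ∧
      s'.clock + energy s' H ≤ s.clock + energy s H + unit N * (5 * degrees N + 1)) s := by
  have hunit : unit N = 20 * (Fintype.card N + 1) := rfl
  simp only [consolidate, wp_bind, wp_rd, wp_wr]
  set s₀ : Mem N T := { s with clock := s.clock + 1 + 1 + 1, roots := [], minRoot := none } with hs₀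
  have hcond : Placing s₀ H s.roots := by
    refine ⟨h.forest, fun w hw => ((h.mem_roots w).1 hw).1, fun w hw => ((h.mem_roots w).1 hw).2,
      h.roots_nodup, ?_, ?_, ?_, ?_, ?_, ?_, ?_, h.key_size⟩
    · intro d x hd
      rw [hs₀, h.slot_none] at hd
      cases hd
    · intro d x hd
      rw [hs₀, h.slot_none] at hd
      cases hd
    · intro d x hd
      rw [hs₀, h.slot_none] at hd
      cases hd
    · intro d x hd
      rw [hs₀, h.slot_none] at hd
      cases hd
    · exact fun x hx hp => .inl ((h.mem_roots x).2 ⟨hx, hp⟩)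
    · intro w hw hd
      rw [hs₀, h.slot_none] at hd
      cases hd
    · simp [hs₀, h.top_eq]
  refine wp_mono (wp_forEach (fun l t => Placing t H l ∧ Placed s₀ t ∧
    t.clock + unit N * tops t.parent H + (unit N + 1) * l.length ≤
      s₀.clock + unit N * tops s₀.parent H + (unit N + 1) * s.roots.length) ?_ s.roots s₀
    ⟨hcond, ⟨⟨rfl, rfl, rfl, rfl⟩, rfl, rfl, rfl, le_rfl⟩, le_rfl⟩) ?_
  · rintro x l t ⟨ht, hst, hc⟩
    refine wp_mono (place_spec (ht.clock _)) ?_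
    rintro - t' ⟨h1, h2, h3⟩
    refine ⟨h1, hst.trans ⟨⟨h2.1.1, h2.1.2, h2.1.3, h2.1.4⟩, h2.2, h2.3, h2.4, h2.5⟩, ?_⟩
    rw [List.length_cons, mul_add _ _ 1] at hc
    dsimp only at h3
    omega
  · rintro - _ ⟨t, ⟨ht, hst, hc⟩, rfl⟩
    simp only [List.length_nil, mul_zero, add_zero] at hc
    -- A slot holds one node, so the degree is injective on the remaining roots, with values below
    -- `top`.
    have htops : tops t.parent H ≤ degrees N := by
      refine le_trans ?_ ht.top_le
      rw [← Finset.card_range t.top]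
      refine Finset.card_le_card_of_injOn t.degree ?_ ?_
      · intro x hx
        simp only [Finset.coe_filter, Set.mem_ofPred_eq] at hx
        have := (ht.cover x hx.1 hx.2).resolve_left (by simp)
        simpa using ht.slot_lt _ _ this
      · intro x hx y hy hxy
        simp only [Finset.coe_filter, Set.mem_ofPred_eq] at hx hy
        have h1 := (ht.cover x hx.1 hx.2).resolve_left (by simp)
        have h2 := (ht.cover y hy.1 hy.2).resolve_left (by simp)
        rw [hxy, h2] at h1
        exact (Option.some.inj h1).symm
    have hroots : t.roots = [] := hst.roots
    have hmin : t.minRoot = none := hst.minRoot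
    -- The roots collected so far take the place of the pending list, so that moving a node from its
    -- slot to the roots is an instance of `Placing.clear`.
    refine wp_mono (wp_forEach (fun l u => Placing u H u.roots ∧ RootMin u ∧
        (∀ d, u.slot d ≠ none → d ∈ l) ∧ Frame t u ∧ u.key = t.key ∧ u.parent = t.parent ∧
        u.mark = t.mark ∧
        u.clock + unit N * l.length ≤ t.clock + 2 + unit N * t.top) ?_ (List.range t.top)
        { t with clock := t.clock + 1 + 1 } ?_) ?_
    · rintro d l u ⟨h1, h2, h3, h4, h5, h6, h7, h8⟩
      rw [List.length_cons, mul_add, mul_one] at h8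
      simp only [wp_bind, wp_rd]
      cases hd : u.slot d with
      | none =>
        simp only [wp_pure]
        refine ⟨h1.clock _, ⟨h2.1, h2.2, h2.3⟩, ?_, ⟨h4.1, h4.2, h4.3, h4.4⟩, h5, h6, h7, ?_⟩
        · intro e he
          rcases List.mem_cons.1 (h3 e he) with rfl | he'
          · exact absurd hd he
          · exact he'
        · omega
      | some x =>
        simp only [wp_bind, wp_wr]
        refine wp_mono (addRoot_spec x ⟨h2.1, h2.2, h2.3⟩ h1.key_size) ?_
        rintro - _ ⟨c, m, hc', rfl, hm⟩
        have h9 := h1.clear hd 0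
        refine ⟨⟨h9.1, h9.2, h9.3, h9.4, h9.5, h9.6, h9.7, h9.8, h9.9, h9.10, h9.11, h9.12⟩, hm,
          ?_, ⟨h4.1, h4.2, h4.3, h4.4⟩, h5, h6, h7, ?_⟩
        · intro e he
          by_cases hed : e = d
          · subst hed; simp at he
          · simp only [ne_eq, hed, not_false_eq_true, Function.update_of_ne] at he
            exact (List.mem_cons.1 (h3 e he)).resolve_left hed
        · dsimp only
          omega
    · refine ⟨?_, ⟨fun _ => hroots, ?_, ?_⟩, ?_, ⟨rfl, rfl, rfl, rfl⟩, rfl, rfl, rfl, ?_⟩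
      · have := ht.clock (t.clock + 1 + 1)
        rwa [← hroots] at this
      · intro m hm
        rw [show ({ t with clock := t.clock + 1 + 1 } : Mem N T).minRoot = none from hmin] at hm
        cases hm
      · intro m hm
        rw [show ({ t with clock := t.clock + 1 + 1 } : Mem N T).minRoot = none from hmin] at hm
        cases hm
      · intro d hd
        obtain ⟨x, hx⟩ := Option.ne_none_iff_exists'.1 hd
        exact List.mem_range.2 (ht.slot_lt d x hx)
      · simp
    · rintro - _ ⟨u, ⟨h1, h2, h3, h4, h5, h6, h7, h8⟩, rfl⟩
      have hslot : ∀ d, u.slot d = none := fun d => by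
        by_contra hd
        simpa using h3 d hd
      refine ⟨Shape.heap ⟨h1.forest, h1.pending_nodup, fun x => ?_, hslot, rfl, h1.key_size⟩
        ⟨h2.1, h2.2, h2.3⟩, ?_, ?_, ?_⟩
      · refine ⟨fun hx => ⟨h1.pending_mem x hx, h1.pending_root x hx⟩, fun hx => ?_⟩
        refine (h1.cover x hx.1 hx.2).resolve_right fun hx' => ?_
        rw [hslot] at hx'
        cases hx'
      · exact h5.trans hst.key
      · have := hst.toFrame.trans h4
        exact ⟨this.1, this.2, this.3, this.4⟩
      · have e1 := h.tops_eq
        have e2 := hst.marks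
        have e3 : unit N * t.top ≤ unit N * degrees N := Nat.mul_le_mul_left _ ht.top_le
        have e4 : unit N * tops t.parent H ≤ unit N * degrees N := Nat.mul_le_mul_left _ htops
        have e5 : unit N * marks t.mark ≤ unit N * marks s.mark := Nat.mul_le_mul_left _ e2
        have e6 : s.roots.length ≤ unit N * s.roots.length :=
          Nat.le_mul_of_pos_left _ (by omega)
        have e7 : s₀.parent = s.parent := rfl
        have e8 : s₀.clock = s.clock + 1 + 1 + 1 := rfl
        rw [e7, e8, e1, add_mul, one_mul] at hc
        simp only [energy, h6, h7, mul_add, mul_left_comm (unit N), e1] at *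
        simp only [List.length_nil, mul_zero, add_zero] at h8
        omega

end heap
-- Removing a minimum and lowering a priority.
section heap
variable {N T : Type} [Fintype N] [DecidableEq N]

/-- The coefficient 11 consists of 5 for consolidation, 3 for the potential of the children that
become roots and 3 for the traversal that releases them; their number is at most `degrees N`. -/
theorem extractMin_spec {s : Mem N T} {H : Finset N} (h : Heap s H) :
    wp extractMin (fun o s' => Frame s s' ∧ s'.key = s.key ∧
      match o with
      | none => H = ∅ ∧ s'.clock = s.clock + 1
      | some z => z ∈ H ∧ (∀ y ∈ H, s.key z ≤ s.key y) ∧ Heap s' (H.erase z) ∧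
        s'.clock + energy s' (H.erase z) ≤
          s.clock + energy s H + unit N * (11 * degrees N + 2)) s := by
  have hunit : unit N = 20 * (Fintype.card N + 1) := rfl
  simp only [extractMin, wp_bind, wp_rd]
  cases hm : s.minRoot with
  | none =>
    simp only [wp_pure]
    exact ⟨⟨rfl, rfl, rfl, rfl⟩, trivial, h.min_none hm, trivial⟩
  | some z =>
    have hzr := h.min_mem z hm
    obtain ⟨hzH, hpz⟩ := (h.mem_roots z).1 hzr
    simp only [wp_bind, wp_rd]
    refine wp_mono (wp_forEach (fun l t => ∃ d, s.children z = d ++ l ∧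
      t = { s with
        clock := s.clock + 2 + 3 * d.length
        parent := fun y => if y ∈ d then none else s.parent y
        roots := d.reverse ++ s.roots }) ?_ (s.children z) _ ⟨[], by simp, by simp [hm]⟩) ?_
    · rintro x l _ ⟨d, hd, rfl⟩
      simp only [wp_bind, wp_wr]
      refine ⟨d ++ [x], by simp [hd], ?_⟩
      simp only [List.length_append, List.length_cons, List.length_nil, List.reverse_append,
        List.reverse_cons, List.reverse_nil, List.nil_append, List.cons_append, Mem.mk.injEq,
        and_true, true_and]
      refine ⟨by omega, ?_⟩
      funext y
      by_cases hy : y = x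
      · subst hy; simp
      · simp [hy]
    · rintro - _ ⟨_, ⟨d, hd, rfl⟩, rfl⟩
      rw [List.append_nil] at hd
      simp only [wp_wr, wp_pure, ← hd]
      have hdisj : ∀ x ∈ s.children z, x ∉ s.roots := by
        intro x hx hxr
        have h1 := ((h.mem_roots x).1 hxr).2
        rw [(h.forest.mem_children z x).1 hx] at h1
        cases h1
      have hnodup : ((s.children z).reverse ++ s.roots).Nodup := by
        refine List.nodup_append'.2 ⟨List.nodup_reverse.2 (h.forest.nodup z), h.roots_nodup, ?_⟩
        exact fun x hx hxr => hdisj x (List.mem_reverse.1 hx) hxr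
      refine wp_mono (consolidate_spec (H := H.erase z) (Shape.mk ?_ ?_ ?_ h.slot_none
        h.top_eq h.key_size)) ?_
      · refine h.forest.extract hpz fun y hy => ?_
        simp [credit, hy]
      · exact hnodup.erase z
      · intro x
        rw [hnodup.mem_erase_iff]
        simp only [List.mem_append, List.mem_reverse, h.mem_roots, Finset.mem_erase]
        by_cases hx : x ∈ s.children z
        · simp [hx, h.forest.child_mem z x ((h.forest.mem_children z x).1 hx)]
        · simp [hx, and_assoc]
      · rintro - s' ⟨h1, h2, h3, h4⟩
        refine ⟨⟨h3.1, h3.2, h3.3, h3.4⟩, h2, hzH, h.min_le z hm, h1, ?_⟩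
        refine le_trans h4 ?_
        have htops : tops (fun y => if y ∈ s.children z then none else s.parent y) (H.erase z) ≤
            tops s.parent H + s.degree z := by
          rw [h.forest.degree_eq, tops, tops]
          refine le_trans (Finset.card_le_card
            (t := (H.filter fun x => s.parent x = none) ∪ (s.children z).toFinset) ?_) ?_
          · intro y hy
            simp only [Finset.mem_filter, Finset.mem_erase, ite_eq_left_iff] at hy
            by_cases hyz : y ∈ s.children z
            · simp [hyz]
            · simp [hy.1.2, hy.2 hyz]
          · refine (Finset.card_union_le _ _).trans ?_
            have := List.toFinset_card_le (s.children z)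
            omega
        have hdeg := h.forest.degree_le (credit_le s) z
        have hdeg' : s.degree z ≤ degrees N := by unfold degrees; omega
        have e1 := Nat.mul_le_mul_left (unit N) htops
        have e2 := Nat.mul_le_mul_left (unit N) hdeg'
        have e3 : degrees N ≤ unit N * degrees N := Nat.le_mul_of_pos_left _ (by omega)
        have e4 := h.forest.degree_eq z
        simp only [energy, mul_add, mul_left_comm (unit N)] at *
        omega

theorem Shape.cut {s : Mem N T} {H : Finset N} {g g' : N → ℕ} (h : Shape s H g) {x y : N}
    (hxy : s.parent x = some y) (hg : ∀ z p, z ≠ x → s.parent z = some p → g z ≤ g' z) (c : ℕ) :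
    Shape { s with
      clock := c
      children := Function.update s.children y ((s.children y).erase x)
      degree := Function.update s.degree y (s.degree y - 1)
      roots := x :: s.roots
      parent := Function.update s.parent x none
      mark := Function.update s.mark x false } H g' := by
  refine ⟨h.forest.cut hxy hg, ?_, ?_, h.slot_none, h.top_eq, h.key_size⟩
  · refine List.nodup_cons.2 ⟨fun hx => ?_, h.roots_nodup⟩
    have := ((h.mem_roots x).1 hx).2
    rw [hxy] at this
    cases this
  · intro z
    by_cases hz : z = x
    · subst hz; simp [h.forest.child_mem _ _ hxy]
    · simp [hz, h.mem_roots]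

omit [Fintype N] in
theorem wp_cut (x y : N) (Q : Unit → Mem N T → Prop) (s : Mem N T) :
    wp (cut x y) Q s ↔ Q () { s with
      clock := s.clock + 5
      children := Function.update s.children y ((s.children y).erase x)
      degree := Function.update s.degree y (s.degree y - 1)
      roots := x :: s.roots
      parent := Function.update s.parent x none
      mark := Function.update s.mark x false } := by
  simp only [cut, wp_bind, wp_wr]

/-- What cutting trees leaves unchanged. -/
structure Pruned (s s' : Mem N T) : Prop extends Frame s s' where
  key : s'.key = s.key
  minRoot : s'.minRoot = s.minRoot
  parent : ∀ z, s.parent z = none → s'.parent z = none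

-- Removing a child lowers the credit of `y` by at most one. The correction at `y` is a debt that
-- the cascading cut has to settle; `x` is excluded because it may lose its mark.
omit [Fintype N] in
theorem credit_cut {s s' : Mem N T} {x y : N}
    (hd : s'.degree = Function.update s.degree y (s.degree y - 1))
    (hm : s'.mark = Function.update s.mark x false) {z : N} (hz : z ≠ x) :
    credit s z ≤ credit s' z + if z = y then 1 else 0 := by
  rw [credit, credit, hd, hm]
  by_cases hzy : z = y
  · subst hzy
    simp [hz]
    omega
  · simp [hz, hzy]

/-- The debt of one at `y` is void if `y` is a root, since a root has no siblings to account for. It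
is settled by marking `y` if `y` is unmarked; otherwise `y` is cut and the debt passes to its
parent. Each such cut removes a mark, worth four units, and creates a tree, worth at most three, so
one unit is left for the round. The number of marks is the decreasing measure. -/
theorem cascadingCut_spec {s : Mem N T} {H : Finset N} {y : N}
    (h : Shape s H fun z => credit s z + if z = y then 1 else 0) :
    wp (cascadingCut y) (fun _ s' => Shape s' H (credit s') ∧ Pruned s s' ∧
      s'.clock + energy s' H ≤ s.clock + energy s H + 5 * unit N) s := by
  have hunit : unit N = 20 * (Fintype.card N + 1) := rfl
  refine wp_loop (fun y t => Shape t H (fun z => credit t z + if z = y then 1 else 0) ∧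
      Pruned s t ∧ t.clock + energy t H ≤ s.clock + energy s H) (fun _ t => marks t.mark) ?_ y s
    ⟨h, ⟨⟨rfl, rfl, rfl, rfl⟩, rfl, rfl, fun _ h => h⟩, le_rfl⟩
  rintro y t ⟨ht, hst, hc⟩
  simp only [wp_bind, wp_rd]
  cases hp : t.parent y with
  | none =>
    simp only [wp_pure]
    refine ⟨⟨ht.forest.congr_credit ?_, ht.2, ht.3, ht.4, ht.5, ht.6⟩,
      ⟨⟨hst.1.1, hst.1.2, hst.1.3, hst.1.4⟩, hst.2, hst.3, hst.4⟩, ?_⟩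
    · intro z p hz
      have hzy : z ≠ y := by
        rintro rfl
        rw [hp] at hz
        cases hz
      simp [hzy, credit]
    · simp only [energy] at *
      omega
  | some p =>
    simp only [wp_bind, wp_rd, wp_ite, wp_cut, wp_pure, wp_wr]
    split_ifs with hmark
    · refine ⟨⟨ht.cut hp (fun z q hz hq => ?_) _, ⟨⟨hst.1.1, hst.1.2, hst.1.3, hst.1.4⟩, hst.2,
        hst.3, ?_⟩, ?_⟩, ?_⟩
      · rw [if_neg hz]
        exact credit_cut rfl rfl hz
      · intro z hz
        by_cases hzy : z = y
        · subst hzy; simp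
        · simpa [hzy] using hst.4 z hz
      · have e1 := tops_cut_le t.parent H y
        have e2 := marks_unmark hmark
        have e3 := Nat.mul_le_mul_left (unit N) e1
        have e4 := congrArg (unit N * ·) e2
        simp only [energy, mul_add, mul_left_comm (unit N), mul_one] at *
        omega
      · have e2 := marks_unmark hmark
        omega
    · refine ⟨⟨ht.forest.congr_credit ?_, ht.2, ht.3, ht.4, ht.5, ht.6⟩,
        ⟨⟨hst.1.1, hst.1.2, hst.1.3, hst.1.4⟩, hst.2, hst.3, hst.4⟩, ?_⟩
      · intro z p hz
        by_cases hzy : z = y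
        · subst hzy; simp [credit, hmark]
        · simp [hzy, credit]
      · have e1 := Nat.mul_le_mul_left (unit N) (marks_mark_le t.mark y)
        simp only [energy, mul_add, mul_left_comm (unit N), mul_one] at *
        omega

theorem decreaseKey_spec {s : Mem N T} {H : Finset N} (h : Heap s H) {x : N} {k : ℕ} (hx : x ∈ H)
    (hk : k ≤ s.key x) :
    wp (decreaseKey x k) (fun _ s' => Heap s' H ∧ s'.key = Function.update s.key x k ∧
      Frame s s' ∧ s'.clock + energy s' H ≤ s.clock + energy s H + 11 * unit N) s := by
  have hunit : unit N = 20 * (Fintype.card N + 1) := rfl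
  have hksize : k.size ≤ Fintype.card N + 1 := (Nat.size_le_size hk).trans (h.key_size x)
  have hks : ∀ y, (Function.update s.key x k y).size ≤ Fintype.card N + 1 := fun y => by
    by_cases hy : y = x
    · subst hy; simpa using hksize
    · simpa [hy] using h.key_size y
  -- The closing update of the minimum, common to all branches. If `x` has kept its parent, its new
  -- priority is at least that of another node and does not undercut the minimum; so the pointer is
  -- moved to `x` only if `x` is a root.
  have hfin : ∀ t : Mem N T, Shape t H (credit t) → Frame s t →
      t.key = Function.update s.key x k → t.minRoot = s.minRoot →
      (∀ z, s.parent z = none → t.parent z = none) →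
      (t.parent x = none ∨ ∃ p ∈ H, p ≠ x ∧ s.key p ≤ k) →
      t.clock + energy t H ≤ s.clock + energy s H + 10 * unit N →
      wp (do
        match ← rd (·.minRoot) with
        | none => pure ()
        | some m =>
          let km ← rdInt (·.key m)
          if ← less k km then
            wr fun s => { s with minRoot := some x })
        (fun _ s' => Heap s' H ∧ s'.key = Function.update s.key x k ∧
          Frame s s' ∧ s'.clock + energy s' H ≤ s.clock + energy s H + 11 * unit N) t := by
    intro t ht hst hkey hmin hroots hxp hc
    simp only [wp_bind, wp_rd]
    cases hm : t.minRoot with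
    | none =>
      have := h.min_none (hmin ▸ hm)
      rw [this] at hx
      simp at hx
    | some m =>
      have hms : s.minRoot = some m := hmin ▸ hm
      have hmr := (h.mem_roots m).1 (h.min_mem m hms)
      have hmle := h.min_le m hms
      have hkm := ht.key_size m
      simp only [wp_bind, wp_rdInt, wp_less, wp_ite, wp_wr, wp_pure, decide_eq_true_eq]
      have hmt : m ∈ t.roots := (ht.mem_roots m).2 ⟨hmr.1, hroots m hmr.2⟩
      split_ifs with hlt
      · refine ⟨⟨⟨ht.1, ht.2, ht.3, ht.4, ht.5, ht.6⟩, ?_, ?_, ?_⟩, hkey,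
          ⟨hst.1, hst.2, hst.3, hst.4⟩, ?_⟩
        · simp
        · simp only [Option.some.injEq]
          rintro _ rfl
          refine (ht.mem_roots x).2 ⟨hx, hxp.resolve_right ?_⟩
          rintro ⟨p, hp, hpx, hpk⟩
          have h1 := hmle p hp
          rw [hkey] at hlt
          by_cases hmx : m = x
          · subst hmx; simp at hlt
          · simp [hmx] at hlt
            omega
        · simp only [Option.some.injEq]
          rintro _ rfl y hy
          rw [hkey]
          by_cases hyx : y = x
          · rw [hyx]
          · have h1 := hmle y hy
            rw [hkey] at hlt
            by_cases hmx : m = x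
            · subst hmx; simp at hlt
            · simp [hmx] at hlt
              simp [hyx]
              omega
        · simp only [energy] at *
          omega
      · refine ⟨⟨⟨ht.1, ht.2, ht.3, ht.4, ht.5, ht.6⟩, ?_, ?_, ?_⟩, hkey,
          ⟨hst.1, hst.2, hst.3, hst.4⟩, ?_⟩
        · exact fun h' => (Option.some_ne_none m h').elim
        · intro m' h'
          obtain rfl := Option.some.inj h'
          exact hmt
        · intro m' h'
          obtain rfl := Option.some.inj h'
          intro y hy
          have h1 := hmle y hy
          simp only [hkey] at hlt ⊢
          by_cases hyx : y = x
          · subst hyx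
            simpa using hlt
          · rw [Function.update_of_ne hyx]
            refine le_trans ?_ h1
            by_cases hmx : m = x
            · subst hmx; simpa using hk
            · simp [hmx]
        · simp only [energy] at *
          omega
  simp only [decreaseKey]
  rw [wp_bind, wp_wrInt, wp_bind, wp_rd]
  cases hp : s.parent x with
  | none =>
    refine hfin _ ⟨h.forest.update_key hk ?_, h.1.2, h.1.3, h.1.4, h.1.5, hks⟩ ⟨rfl, rfl, rfl, rfl⟩ rfl rfl
      (fun _ h => h) (.inl hp) ?_
    · intro y hy
      rw [hp] at hy
      cases hy
    · simp only [energy]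
      omega
  | some y =>
    have hyx : y ≠ x := (h.forest.ne_of_parent hp).symm
    have hyH := h.forest.parent_mem _ _ hp
    have hky := h.key_size y
    have hkey : Function.update s.key x k y = s.key y := Function.update_of_ne hyx _ _
    simp only [wp_bind, wp_rdInt, wp_less, wp_ite, wp_cut, decide_eq_true_eq]
    rw [hkey]
    split_ifs with hlt
    -- The cut is analysed with the old keys. After it `x` is a root, so lowering its key cannot
    -- violate the heap order.
    · have hcut := Shape.cut (g' := fun z => credit { s with
          degree := Function.update s.degree y (s.degree y - 1)
          mark := Function.update s.mark x false } z + if z = y then 1 else 0)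
        h.toShape hp (fun z _ hz _ => credit_cut rfl rfl hz) 0
      refine wp_mono (cascadingCut_spec (H := H) ⟨hcut.forest.update_key hk ?_, hcut.2, hcut.3,
        hcut.4, hcut.5, hks⟩) ?_
      · intro z hz
        simp at hz
      · rintro - t ⟨h1, h2, h3⟩
        have := hfin t h1 ⟨h2.1.1, h2.1.2, h2.1.3, h2.1.4⟩ h2.key h2.minRoot ?_ ?_ ?_
        · rw [wp_bind] at this
          exact this
        · intro z hz
          refine h2.parent z ?_
          by_cases hzx : z = x
          · subst hzx; simp
          · simpa [hzx] using hz
        · exact .inl (h2.parent x (by simp))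
        · have e1 := Nat.mul_le_mul_left (unit N) (tops_cut_le s.parent H x)
          have e2 := Nat.mul_le_mul_left (unit N) (marks_unmark_le s.mark x)
          simp only [energy, mul_add, mul_left_comm (unit N), mul_one] at *
          omega
    · have := hfin { s with
          clock := s.clock + (1 + k.size) + 1 + (1 + (s.key y).size) +
            (1 + k.size + (s.key y).size)
          key := Function.update s.key x k }
        ⟨h.forest.update_key hk ?_, h.1.2, h.1.3, h.1.4, h.1.5, hks⟩ ⟨rfl, rfl, rfl, rfl⟩ rfl rfl
        (fun _ h => h) (.inr ⟨y, hyH, hyx, not_lt.1 hlt⟩) ?_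
      · rw [wp_bind] at this
        exact this
      · intro z hz
        rw [hp] at hz
        cases hz
        exact not_lt.1 hlt
      · simp only [energy]
        omega

end heap
-- The invariant of the algorithm and the procedure `produce`.
section invariant
variable {N T : Type}

/-- The value of a partial mapping to the integers, and `0` where it is not defined. -/
def value (cost : N → Option ℕ) (x : N) : ℕ := (cost x).getD 0

/-- The cost that a rule gives to its left-hand side. -/
def bound (cost : N → Option ℕ) : Rule N T → ℕ
  | .term _ _ => 1
  | .pair _ x y => value cost x + value cost y

/-- All non-terminals on the right-hand side of the rule satisfy `p`. -/
def RhsAll (p : N → Prop) : Rule N T → Prop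
  | .term _ _ => True
  | .pair _ x y => p x ∧ p y

theorem RhsAll.imp {p q : N → Prop} (h : ∀ x, p x → q x) :
    ∀ {r : Rule N T}, RhsAll p r → RhsAll q r
  | .term _ _, _ => trivial
  | .pair _ _ _, hr => ⟨h _ hr.1, h _ hr.2⟩

theorem bound_mono {cost cost' : N → Option ℕ} {p : N → Prop}
    (h : ∀ x, p x → value cost x ≤ value cost' x) :
    ∀ {r : Rule N T}, RhsAll p r → bound cost r ≤ bound cost' r
  | .term _ _, _ => le_rfl
  | .pair _ _ _, hr => Nat.add_le_add (h _ hr.1) (h _ hr.2)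

/-- The invariant of the algorithm: `D` is the set of the non-terminals that have been removed from
the queue, `H` is the queue, `θ` separates the costs, and the rules with the property `pend` may
still have to be taken into account. -/
structure Inv [DecidableEq N] (P : Set (Rule N T)) (cost : N → Option ℕ)
    (chosen : N → Option (Rule N T)) (D H : Finset N) (θ : ℕ) (pend : Rule N T → Prop) :
    Prop where
  disjoint : ∀ x ∈ D, x ∉ H
  dom : ∀ x, (cost x).isSome ↔ x ∈ D ∨ x ∈ H
  pos : ∀ x, (cost x).isSome → 1 ≤ value cost x
  done_le : ∀ x ∈ D, value cost x ≤ θ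
  le_queued : ∀ x ∈ H, θ ≤ value cost x
  exists_chosen : ∀ x, (cost x).isSome → ∃ r, chosen x = some r
  chosen_mem : ∀ x r, chosen x = some r → r ∈ P
  chosen_head : ∀ x r, chosen x = some r → r.head = x
  chosen_dom : ∀ x r, chosen x = some r → (cost x).isSome
  chosen_rhs : ∀ x r, chosen x = some r → RhsAll (fun y => (cost y).isSome) r
  chosen_le : ∀ x r, chosen x = some r → bound cost r ≤ value cost x
  closed_dom : ∀ r ∈ P, RhsAll (· ∈ D) r → ¬pend r → (cost r.head).isSome
  closed : ∀ r ∈ P, RhsAll (· ∈ D) r → ¬pend r → value cost r.head ≤ bound cost r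
  small : ∀ x, value cost x ≤ 2 ^ (D ∪ H).card

namespace Inv
variable [DecidableEq N] {P : Set (Rule N T)} {cost : N → Option ℕ}
  {chosen : N → Option (Rule N T)} {D H : Finset N} {θ : ℕ} {pend pend' : Rule N T → Prop}

theorem size_le [Fintype N] (h : Inv P cost chosen D H θ pend) (x : N) :
    (value cost x).size ≤ Fintype.card N + 1 := by
  rw [Nat.size_le]
  refine lt_of_le_of_lt ((h.small x).trans
    (Nat.pow_le_pow_right (by omega) (Finset.card_le_univ _))) ?_
  exact Nat.pow_lt_pow_right (by omega) (by omega)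

theorem mono (h : Inv P cost chosen D H θ pend)
    (hp : ∀ r ∈ P, RhsAll (· ∈ D) r → pend r → pend' r) : Inv P cost chosen D H θ pend' :=
  { h with
    closed_dom := fun r hr hD hn => h.closed_dom r hr hD fun hpr => hn (hp r hr hD hpr)
    closed := fun r hr hD hn => h.closed r hr hD fun hpr => hn (hp r hr hD hpr) }

/-- A rule that does not improve its head needs no action and stops being pending. -/
theorem skip (h : Inv P cost chosen D H θ pend) {r : Rule N T} (hd : (cost r.head).isSome)
    (hle : value cost r.head ≤ bound cost r) :
    Inv P cost chosen D H θ (fun r' => pend r' ∧ r' ≠ r) :=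
  { h with
    closed_dom := fun r' hr' hD hn => by
      by_cases hrr : r' = r
      · exact hrr ▸ hd
      · exact h.closed_dom r' hr' hD fun hp => hn ⟨hp, hrr⟩
    closed := fun r' hr' hD hn => by
      by_cases hrr : r' = r
      · exact hrr ▸ hle
      · exact h.closed r' hr' hD fun hp => hn ⟨hp, hrr⟩ }

/-- Existing costs never rise, and those on `D` do not change. So the bounds of chosen rules can
only fall, while the bounds of rules over `D` stay fixed and their heads can only get cheaper. -/
theorem update (h : Inv P cost chosen D H θ pend) {r : Rule N T} (hr : r ∈ P)
    (hrhs : RhsAll (fun y => (cost y).isSome) r) (hD : r.head ∉ D)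
    (hle : (cost r.head).isSome → bound cost r ≤ value cost r.head) (hθ : θ ≤ bound cost r) :
    Inv P (Function.update cost r.head (some (bound cost r)))
      (Function.update chosen r.head (some r)) D (Insert.insert r.head H) θ
      (fun r' => pend r' ∧ r' ≠ r) := by
  set d := r.head with hd
  set k := bound cost r with hk
  set cost' := Function.update cost d (some k) with hcost'
  have hself : value cost' d = k := by simp [value, hcost']
  have hother : ∀ x, x ≠ d → value cost' x = value cost x := fun x hx => by
    simp [value, hcost', hx]
  have hsome : ∀ x, (cost' x).isSome ↔ x = d ∨ (cost x).isSome := fun x => by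
    by_cases hx : x = d
    · subst hx; simp [hcost']
    · simp [hcost', hx]
  have hmono : ∀ x, (cost x).isSome → value cost' x ≤ value cost x := fun x hx => by
    by_cases hxd : x = d
    · rw [hxd, hself]
      exact hle (hxd ▸ hx)
    · exact (hother x hxd).le
  have hDeq : ∀ x ∈ D, value cost' x = value cost x := fun x hx =>
    hother x fun e => hD (e ▸ hx)
  have hkpos : 1 ≤ k := by
    rw [hk]
    cases r with
    | term => exact le_rfl
    | pair _ e f => exact (h.pos e hrhs.1).trans (Nat.le_add_right _ _)
  have hchosen : ∀ x r', Function.update chosen d (some r) x = some r' →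
      (x = d ∧ r' = r) ∨ (x ≠ d ∧ chosen x = some r') := by
    intro x r' hx
    by_cases hxd : x = d
    · subst hxd
      rw [Function.update_self] at hx
      exact .inl ⟨rfl, (Option.some.inj hx).symm⟩
    · exact .inr ⟨hxd, by simpa [hxd] using hx⟩
  have himp : ∀ {r' : Rule N T}, RhsAll (fun y => (cost y).isSome) r' →
      RhsAll (fun y => (cost' y).isSome) r' := RhsAll.imp fun x hx => (hsome x).2 (.inr hx)
  refine ⟨?_, ?_, ?_, ?_, ?_, ?_, ?_, ?_, ?_, ?_, ?_, ?_, ?_, ?_⟩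
  · intro x hx
    rw [Finset.mem_insert, not_or]
    exact ⟨fun e => hD (e ▸ hx), h.disjoint x hx⟩
  · intro x
    rw [hsome, h.dom, Finset.mem_insert]
    tauto
  · intro x hx
    by_cases hxd : x = d
    · rw [hxd, hself]
      exact hkpos
    · rw [hother x hxd]
      exact h.pos x (((hsome x).1 hx).resolve_left hxd)
  · intro x hx
    rw [hDeq x hx]
    exact h.done_le x hx
  · intro x hx
    by_cases hxd : x = d
    · rw [hxd, hself]
      exact hθ
    · rw [hother x hxd]
      exact h.le_queued x ((Finset.mem_insert.1 hx).resolve_left hxd)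
  · intro x hx
    by_cases hxd : x = d
    · exact ⟨r, by simp [hxd]⟩
    · simpa [hxd] using h.exists_chosen x (((hsome x).1 hx).resolve_left hxd)
  · intro x r' hx
    rcases hchosen x r' hx with ⟨-, rfl⟩ | ⟨-, hx⟩
    · exact hr
    · exact h.chosen_mem x r' hx
  · intro x r' hx
    rcases hchosen x r' hx with ⟨rfl, rfl⟩ | ⟨-, hx⟩
    · rfl
    · exact h.chosen_head x r' hx
  · intro x r' hx
    rw [hsome]
    rcases hchosen x r' hx with ⟨rfl, -⟩ | ⟨-, hx⟩
    · exact .inl rfl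
    · exact .inr (h.chosen_dom x r' hx)
  · intro x r' hx
    rcases hchosen x r' hx with ⟨-, rfl⟩ | ⟨-, hx⟩
    · exact himp hrhs
    · exact himp (h.chosen_rhs x r' hx)
  · intro x r' hx
    rcases hchosen x r' hx with ⟨rfl, rfl⟩ | ⟨hxd, hx⟩
    · rw [hself]
      exact bound_mono hmono hrhs
    · rw [hother x hxd]
      exact (bound_mono hmono (h.chosen_rhs x r' hx)).trans (h.chosen_le x r' hx)
  · intro r' hr' hD' hn
    rw [hsome]
    by_cases hrr : r' = r
    · exact .inl (hrr ▸ rfl)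
    · exact .inr (h.closed_dom r' hr' hD' fun hp => hn ⟨hp, hrr⟩)
  · intro r' hr' hD' hn
    have h1 : bound cost r' ≤ bound cost' r' := bound_mono (fun x hx => (hDeq x hx).ge) hD'
    refine le_trans ?_ h1
    by_cases hrr : r' = r
    · rw [hrr, ← hd, hself]
    · have hnp : ¬pend r' := fun hp => hn ⟨hp, hrr⟩
      exact (hmono _ (h.closed_dom r' hr' hD' hnp)).trans (h.closed r' hr' hD' hnp)
  · intro x
    have hcard : (D ∪ H).card ≤ (D ∪ Insert.insert d H).card :=
      Finset.card_le_card (Finset.union_subset_union_right (Finset.subset_insert _ _))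
    have hpow : 2 ^ (D ∪ H).card ≤ 2 ^ (D ∪ Insert.insert d H).card :=
      Nat.pow_le_pow_right (by omega) hcard
    by_cases hxd : x = d
    · rw [hxd, hself]
      by_cases hdom : (cost d).isSome
      · exact (hle hdom).trans ((h.small d).trans hpow)
      · rw [h.dom, ← Finset.mem_union] at hdom
        -- A new head raises the exponent by one, and the doubled power covers a sum of two old
        -- costs.
        have h2 : (D ∪ Insert.insert d H).card = (D ∪ H).card + 1 := by
          rw [Finset.union_insert, Finset.card_insert_of_notMem hdom]
        rw [h2, pow_succ, hk]
        cases r with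
        | term =>
          have : 1 ≤ 2 ^ (D ∪ H).card := Nat.one_le_two_pow
          simp only [bound]
          omega
        | pair _ e f =>
          have h3 := h.small e
          have h4 := h.small f
          simp only [bound]
          omega
    · rw [hother x hxd]
      exact (h.small x).trans hpow

/-- Since `a` is minimal in the queue, its cost separates the enlarged `D` from the rest. Rules that
become relevant only through `a` must be pending from now on; `hp` requires this. -/
theorem pop (h : Inv P cost chosen D H θ pend) {a : N} (ha : a ∈ H)
    (hmin : ∀ y ∈ H, value cost a ≤ value cost y)
    (hp : ∀ r ∈ P, RhsAll (· ∈ Insert.insert a D) r → ¬pend' r → RhsAll (· ∈ D) r ∧ ¬pend r) :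
    Inv P cost chosen (Insert.insert a D) (H.erase a) (value cost a) pend' :=
  { h with
    disjoint := fun x hx hxH => by
      rw [Finset.mem_erase] at hxH
      exact h.disjoint x ((Finset.mem_insert.1 hx).resolve_left hxH.1) hxH.2
    dom := fun x => by
      rw [h.dom, Finset.mem_insert, Finset.mem_erase]
      by_cases hx : x = a
      · simp [hx, ha]
      · simp [hx]
    done_le := fun x hx => by
      rcases Finset.mem_insert.1 hx with rfl | hx
      · exact le_rfl
      · exact (h.done_le x hx).trans (h.le_queued a ha)
    le_queued := fun x hx => hmin x (Finset.mem_of_mem_erase hx)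
    closed_dom := fun r hr hD hn => h.closed_dom r hr (hp r hr hD hn).1 (hp r hr hD hn).2
    closed := fun r hr hD hn => h.closed r hr (hp r hr hD hn).1 (hp r hr hD hn).2
    small := fun x => by
      have : Insert.insert a D ∪ H.erase a = D ∪ H := by
        ext y
        by_cases hy : y = a
        · simp [hy, ha]
        · simp [hy]
      rw [this]
      exact h.small x }

end Inv

/-- The memory during a run of the algorithm. -/
structure Good [Fintype N] [DecidableEq N] (P : Set (Rule N T)) (s : Mem N T) (D H : Finset N)
    (θ : ℕ) (pend : Rule N T → Prop) : Prop where
  heap : Heap s H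
  inv : Inv P s.cost s.chosen D H θ pend
  key : s.key = value s.cost

/-- The index of the rules is the same. -/
structure SameIndex (s s' : Mem N T) : Prop where
  withFirst : s'.withFirst = s.withFirst
  withSecond : s'.withSecond = s.withSecond

variable [Fintype N] [DecidableEq N]

omit [DecidableEq N] in
theorem Heap.congr {s s' : Mem N T} {H : Finset N} (h : Heap s H) (c : ℕ) (cost : N → Option ℕ)
    (chosen : N → Option (Rule N T))
    (hs : s' = { s with clock := c, cost := cost, chosen := chosen }) : Heap s' H := by
  subst hs
  exact ⟨⟨h.1.1, h.1.2, h.1.3, h.1.4, h.1.5, h.1.6⟩, h.2, h.3, h.4⟩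

theorem Good.clock {P : Set (Rule N T)} {s : Mem N T} {D H : Finset N} {θ : ℕ}
    {pend : Rule N T → Prop} (h : Good P s D H θ pend) (c : ℕ) :
    Good P { s with clock := c } D H θ pend :=
  ⟨h.heap.congr c _ _ rfl, h.inv, h.key⟩

omit [Fintype N] in
theorem value_update (cost : N → Option ℕ) (d : N) (k : ℕ) :
    value (Function.update cost d (some k)) = Function.update (value cost) d k := by
  funext x
  by_cases hx : x = d
  · subst hx; simp [value]
  · simp [value, hx]

omit [Fintype N] in
theorem wp_record (a : N) (k : ℕ) (r : Rule N T) (Q : Unit → Mem N T → Prop) (s : Mem N T) :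
    wp (record a k r) Q s ↔ Q () { s with
      clock := s.clock + (1 + k.size) + 1
      cost := Function.update s.cost a (some k)
      chosen := Function.update s.chosen a (some r) } := by
  simp only [record, wp_bind, wp_wrInt, wp_wr]

theorem record_insert_spec {P : Set (Rule N T)} {s : Mem N T} {D H : Finset N} {θ : ℕ}
    {pend : Rule N T → Prop} (h : Good P s D H θ pend) {r : Rule N T} (hr : r ∈ P)
    (hrhs : RhsAll (fun y => (s.cost y).isSome) r) (hd : ¬(s.cost r.head).isSome)
    (hθ : θ ≤ bound s.cost r) {d : N} {k : ℕ} (hrd : r.head = d) (hk : bound s.cost r = k) :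
    wp (record d k r) (fun _ t => wp (insert d k)
      (fun _ s' => Good P s' D (Insert.insert d H) θ (fun r' => pend r' ∧ r' ≠ r) ∧
        SameIndex s s' ∧ s'.cost = Function.update s.cost d (some k) ∧
        s'.clock + energy s' (Insert.insert d H) ≤ s.clock + energy s H + 5 * unit N) t) s := by
  subst hrd hk
  have hunit : unit N = 20 * (Fintype.card N + 1) := rfl
  have hnot := mt (h.inv.dom r.head).2 hd
  rw [not_or] at hnot
  have hinv := h.inv.update hr hrhs hnot.1 (fun h' => absurd h' hd) hθ
  have hsize := hinv.size_le r.head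
  rw [value_update, Function.update_self] at hsize
  rw [wp_record]
  refine wp_mono (insert_spec (h.heap.congr _ _ _ rfl) hnot.2 hsize) ?_
  rintro - s' ⟨h1, h2, h3, h4⟩
  have hc : s'.cost = _ := h3.cost
  have hch : s'.chosen = _ := h3.chosen
  refine ⟨⟨h1, ?_, ?_⟩, ⟨h3.3, h3.4⟩, hc, ?_⟩
  · rw [hc, hch]
    exact hinv
  · rw [h2, hc, value_update, ← h.key]
  · simp only [energy] at *
    omega

theorem record_decrease_spec {P : Set (Rule N T)} {s : Mem N T} {D H : Finset N} {θ : ℕ}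
    {pend : Rule N T → Prop} (h : Good P s D H θ pend) {r : Rule N T} (hr : r ∈ P)
    (hrhs : RhsAll (fun y => (s.cost y).isSome) r) (hd : (s.cost r.head).isSome)
    (hlt : bound s.cost r < value s.cost r.head) (hθ : θ ≤ bound s.cost r) {d : N} {k : ℕ}
    (hrd : r.head = d) (hk : bound s.cost r = k) :
    wp (record d k r) (fun _ t => wp (decreaseKey d k)
      (fun _ s' => Good P s' D (Insert.insert d H) θ (fun r' => pend r' ∧ r' ≠ r) ∧
        SameIndex s s' ∧ s'.cost = Function.update s.cost d (some k) ∧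
        s'.clock + energy s' (Insert.insert d H) ≤ s.clock + energy s H + 12 * unit N) t) s := by
  subst hrd hk
  have hunit : unit N = 20 * (Fintype.card N + 1) := rfl
  -- Costs on `D` are at most `θ`, and the new cost is at least `θ`; hence a head that improves is
  -- still in the queue.
  have hD : r.head ∉ D := fun hD => by
    have := h.inv.done_le _ hD
    omega
  have hH := ((h.inv.dom r.head).1 hd).resolve_left hD
  have hinv := h.inv.update hr hrhs hD (fun _ => hlt.le) hθ
  have hsize := hinv.size_le r.head
  rw [value_update, Function.update_self] at hsize
  have hins := Finset.insert_eq_of_mem hH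
  rw [hins] at hinv ⊢
  rw [wp_record]
  refine wp_mono (decreaseKey_spec (h.heap.congr _ _ _ rfl) hH ?_) ?_
  · dsimp only
    rw [h.key]
    exact hlt.le
  rintro - s' ⟨h1, h2, h3, h4⟩
  have hc : s'.cost = _ := h3.cost
  have hch : s'.chosen = _ := h3.chosen
  refine ⟨⟨h1, ?_, ?_⟩, ⟨h3.3, h3.4⟩, hc, ?_⟩
  · rw [hc, hch]
    exact hinv
  · rw [h2, hc, value_update, ← h.key]
  · simp only [energy] at *
    omega

theorem produce_spec {P : Set (Rule N T)} {s : Mem N T} {D H : Finset N} {θ : ℕ}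
    {pend : Rule N T → Prop} (h : Good P s D H θ pend) {d e f : N} (hr : .pair d e f ∈ P)
    (he : (s.cost e).isSome) (hf : (s.cost f).isSome) (hθ : θ < value s.cost e + value s.cost f) :
    wp (produce d e f) (fun _ s' => ∃ H',
      Good P s' D H' θ (fun r' => pend r' ∧ r' ≠ .pair d e f) ∧ SameIndex s s' ∧
      (∀ x ∈ D, s'.cost x = s.cost x) ∧
      s'.clock + energy s' H' ≤ s.clock + energy s H + 13 * unit N) s := by
  have hunit : unit N = 20 * (Fintype.card N + 1) := rfl
  have hse := h.inv.size_le e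
  have hsf := h.inv.size_le f
  have hsd := h.inv.size_le d
  -- Before it is compared, a sum may be one bit longer than a stored cost.
  have hsk : (value s.cost e + value s.cost f).size ≤ Fintype.card N + 2 := by
    rw [Nat.size_le] at hse hsf ⊢
    rw [pow_succ]
    omega
  unfold value at hse hsf hsd hsk
  simp only [produce, rdCost, hasCost, wp_bind, wp_rdInt, wp_plus, wp_rd, wp_ite]
  split_ifs with hd
  · simp only [wp_less, wp_pure, decide_eq_true_eq]
    split_ifs with hlt
    · have hrec := fun c => record_decrease_spec (h.clock c) hr ⟨he, hf⟩ hd hlt hθ.le (d := d)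
        (k := (s.cost e).getD 0 + (s.cost f).getD 0) rfl rfl
      refine wp_mono (hrec _) fun _ t ht => wp_mono ht ?_
      rintro - s' ⟨h1, h2, h3, h4⟩
      refine ⟨_, h1, ⟨h2.1, h2.2⟩, ?_, ?_⟩
      · intro x hx
        have hxd : x ≠ d := by
          rintro rfl
          have h5 := h.inv.done_le x hx
          unfold value at *
          omega
        rw [h3]
        exact Function.update_of_ne hxd _ _
      · simp only [energy] at *
        omega
    · refine ⟨H, ⟨h.heap.congr _ _ _ rfl, h.inv.skip hd (not_lt.1 hlt), h.key⟩, ⟨rfl, rfl⟩,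
        fun _ _ => trivial, ?_⟩
      simp only [energy]
      omega
  · have hrec := fun c => record_insert_spec (h.clock c) hr ⟨he, hf⟩ hd hθ.le (d := d)
      (k := (s.cost e).getD 0 + (s.cost f).getD 0) rfl rfl
    refine wp_mono (hrec _) fun _ t ht => wp_mono ht ?_
    rintro - s' ⟨h1, h2, h3, h4⟩
    refine ⟨_, h1, ⟨h2.1, h2.2⟩, ?_, ?_⟩
    · intro x hx
      have hxd : x ≠ d := by
        rintro rfl
        exact hd ((h.inv.dom x).2 (.inl hx))
      rw [h3]
      exact Function.update_of_ne hxd _ _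
    · simp only [energy] at *
      omega

end invariant
-- The loops of the algorithm and its total running time.
section algorithm
variable {N T : Type} [Fintype N] [DecidableEq N]

theorem sum_length_update {α : Type} (f : N → List α) (a : N) (p : α) :
    ∑ x, (Function.update f a (p :: f a) x).length = ∑ x, (f x).length + 1 := by
  have : ∀ x, (Function.update f a (p :: f a) x).length =
      (f x).length + if x = a then 1 else 0 := fun x => by
    by_cases hx : x = a
    · subst hx; simp
    · simp [hx]
  simp [this, Finset.sum_add_distrib]

/-- The memory holds the index of the rules in the list. -/
structure Index (L : List (Rule N T)) (first second : N → List (N × N)) : Prop where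
  mem_first : ∀ a c b, (c, b) ∈ first a ↔ .pair c a b ∈ L
  mem_second : ∀ a c b, (c, b) ∈ second a ↔ .pair c b a ∈ L
  sum_le : ∑ a, (first a).length + ∑ a, (second a).length ≤ 2 * L.length

theorem buildIndex_spec (L : List (Rule N T)) (s : Mem N T) (h₁ : s.withFirst = fun _ => [])
    (h₂ : s.withSecond = fun _ => []) :
    wp (buildIndex L) (fun _ s' => ∃ c first second,
      s' = { s with clock := c, withFirst := first, withSecond := second } ∧
      Index L first second ∧ c ≤ s.clock + 3 * L.length + 1) s := by
  refine wp_mono (wp_forEach (fun l t => ∃ c first second d, L = d ++ l ∧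
    t = { s with clock := c, withFirst := first, withSecond := second } ∧
    Index d first second ∧ c ≤ s.clock + 3 * d.length) ?_ L s ?_) ?_
  · rintro r l _ ⟨c, first, second, d, hd, rfl, hi, hc⟩
    cases r with
    | term a t =>
      rw [wp_pure]
      refine ⟨_, _, _, d ++ [.term a t], by simp [hd], rfl, ⟨?_, ?_, ?_⟩, ?_⟩
      · simpa using hi.1
      · simpa using hi.2
      · have := hi.3
        simp only [List.length_append, List.length_cons, List.length_nil]
        omega
      · simp only [List.length_append, List.length_cons, List.length_nil]
        omega
    | pair c a b =>
      simp only [wp_bind, wp_wr]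
      refine ⟨_, _, _, d ++ [.pair c a b], by simp [hd], rfl, ⟨?_, ?_, ?_⟩, ?_⟩
      · intro x y z
        by_cases hx : x = a
        · subst hx
          simp only [Function.update_self, List.mem_cons, Prod.mk.injEq, hi.1, List.mem_append,
            Rule.pair.injEq, List.not_mem_nil, or_false, true_and]
          tauto
        · simp [hx, hi.1]
      · intro x y z
        by_cases hx : x = b
        · subst hx
          simp only [Function.update_self, List.mem_cons, Prod.mk.injEq, hi.2, List.mem_append,
            Rule.pair.injEq, List.not_mem_nil, or_false, and_true]
          tauto
        · simp [hx, hi.2]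
      · have := hi.3
        simp only [sum_length_update, List.length_append, List.length_cons, List.length_nil]
        omega
      · simp only [List.length_append, List.length_cons, List.length_nil]
        omega
  · refine ⟨s.clock, fun _ => [], fun _ => [], [], rfl, ?_, ⟨?_, ?_, ?_⟩, ?_⟩
    · cases s
      cases h₁
      cases h₂
      rfl
    all_goals simp
  · rintro - _ ⟨_, ⟨c, first, second, d, hd, rfl, hi, hc⟩, rfl⟩
    rw [List.append_nil] at hd
    subst hd
    exact ⟨_, _, _, rfl, hi, by dsimp only; omega⟩

/-- All costs set here are 1, so a further rule for the same head cannot improve it. Rules with two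
non-terminals need no action, since no right-hand side lies in the empty `D`. -/
theorem firstLoop_spec {P : Set (Rule N T)} {s : Mem N T} {L : List (Rule N T)}
    (hL : ∀ r ∈ L, r ∈ P) (h : Good P s ∅ ∅ 1 (· ∈ L)) (h₁ : ∀ x, value s.cost x ≤ 1) :
    wp (firstLoop L) (fun _ s' => ∃ H, Good P s' ∅ H 1 (fun _ => False) ∧ SameIndex s s' ∧
      s'.clock + energy s' H ≤ s.clock + energy s ∅ + 6 * unit N * L.length + 1) s := by
  have hunit : unit N = 20 * (Fintype.card N + 1) := rfl
  refine wp_mono (wp_forEach (fun l t => ∃ H, Good P t ∅ H 1 (· ∈ l) ∧ SameIndex s t ∧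
    (∀ x, value t.cost x ≤ 1) ∧ (∀ r ∈ l, r ∈ P) ∧
    t.clock + energy t H + 6 * unit N * l.length ≤
      s.clock + energy s ∅ + 6 * unit N * L.length) ?_ L s
    ⟨∅, h, ⟨rfl, rfl⟩, h₁, hL, le_rfl⟩) ?_
  · rintro r l t ⟨H, hg, hi, hv, hP, hc⟩
    rw [List.length_cons, mul_add, mul_one] at hc
    have hP' : ∀ r ∈ l, r ∈ P := fun r hr => hP r (List.mem_cons_of_mem _ hr)
    have hmono : ∀ r', r' ∈ r :: l ∧ r' ≠ r → r' ∈ l := fun r' hr' =>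
      (List.mem_cons.1 hr'.1).resolve_left hr'.2
    cases r with
    | pair c a b =>
      rw [wp_pure]
      refine ⟨H, ⟨hg.heap.congr _ _ _ rfl, hg.inv.mono ?_, hg.key⟩, ⟨hi.1, hi.2⟩, hv, hP', ?_⟩
      · intro r _ hr hrl
        rcases List.mem_cons.1 hrl with rfl | hrl
        · simp [RhsAll] at hr
        · exact hrl
      · simp only [energy] at *
        omega
    | term a σ =>
      simp only [hasCost, wp_bind, wp_rd, wp_ite, wp_pure]
      split_ifs with ha
      · refine ⟨H, ⟨hg.heap.congr _ _ _ rfl, ?_, hg.key⟩, ⟨hi.1, hi.2⟩, hv, hP', ?_⟩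
        · exact (hg.inv.skip (r := .term a σ) ha (hv a)).mono fun r _ _ hr => hmono r hr
        · simp only [energy] at *
          omega
      · have hrec := fun c => record_insert_spec (hg.clock c) (r := .term a σ) (hP _ (by simp))
          trivial ha le_rfl (d := a) (k := 1) rfl rfl
        refine wp_mono (hrec _) fun _ t ht => wp_mono ht ?_
        rintro - s' ⟨h1, h2, h3, h4⟩
        refine ⟨_, ⟨h1.heap, h1.inv.mono fun r _ _ hr => hmono r hr, h1.key⟩,
          ⟨h2.1.trans hi.1, h2.2.trans hi.2⟩, ?_, hP', ?_⟩
        · intro x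
          rw [h3, value_update]
          by_cases hx : x = a
          · simp [hx]
          · simpa [hx] using hv x
        · simp only [energy] at *
          omega
  · rintro - _ ⟨t, ⟨H, hg, hi, -, -, hc⟩, rfl⟩
    refine ⟨H, ⟨hg.heap.congr _ _ _ rfl, hg.inv.mono fun r _ _ hr => ?_, hg.key⟩,
      ⟨hi.1, hi.2⟩, ?_⟩
    · simp at hr
    · simp only [energy, List.length_nil, mul_zero, add_zero] at *
      omega

/-- A loop over rules that have the non-terminal just removed from the queue on their right-hand
side. -/
theorem produceLoop_spec {α : Type} {P : Set (Rule N T)} {D : Finset N} {a : N} {θ : ℕ}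
    {s : Mem N T} {H : Finset N} {l : List α} (head other left right : α → N)
    (pend : Rule N T → Prop) (ha : a ∈ D)
    (hlr : ∀ p, left p = a ∧ right p = other p ∨ left p = other p ∧ right p = a)
    (hP : ∀ p ∈ l, .pair (head p) (left p) (right p) ∈ P) (hθ : value s.cost a = θ)
    (h : Good P s D H θ fun r => pend r ∨ ∃ p ∈ l, r = .pair (head p) (left p) (right p)) :
    wp (forEach (fun p => do
        if ← hasCost (other p) then
          produce (head p) (left p) (right p)) l)
      (fun _ s' => ∃ H', Good P s' D H' θ pend ∧ value s'.cost a = θ ∧ SameIndex s s' ∧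
        s'.clock + energy s' H' ≤ s.clock + energy s H + 14 * unit N * l.length + 1) s := by
  have hunit : unit N = 20 * (Fintype.card N + 1) := rfl
  refine wp_mono (wp_forEach (fun l' t => ∃ H', Good P t D H' θ
      (fun r => pend r ∨ ∃ p ∈ l', r = .pair (head p) (left p) (right p)) ∧
    value t.cost a = θ ∧ SameIndex s t ∧
    (∀ p ∈ l', .pair (head p) (left p) (right p) ∈ P) ∧
    t.clock + energy t H' + 14 * unit N * l'.length ≤
      s.clock + energy s H + 14 * unit N * l.length) ?_ l s
    ⟨H, h, hθ, ⟨rfl, rfl⟩, hP, le_rfl⟩) ?_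
  · rintro p l t ⟨H', hg, hθ, hi, hP, hc⟩
    rw [List.length_cons, mul_add, mul_one] at hc
    have hP' : ∀ p ∈ l, .pair (head p) (left p) (right p) ∈ P := fun q hq =>
      hP q (List.mem_cons_of_mem _ hq)
    have hda : (t.cost a).isSome := (hg.inv.dom a).2 (.inl ha)
    simp only [hasCost, wp_bind, wp_rd, wp_ite, wp_pure]
    split_ifs with hb
    · have hpos := hg.inv.pos _ hb
      refine wp_mono (produce_spec (hg.clock _) (hP p (by simp)) ?_ ?_ ?_) ?_
      · rcases hlr p with ⟨e1, -⟩ | ⟨e1, -⟩ <;> rw [e1] <;> assumption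
      · rcases hlr p with ⟨-, e2⟩ | ⟨-, e2⟩ <;> rw [e2] <;> assumption
      · dsimp only
        rcases hlr p with ⟨e1, e2⟩ | ⟨e1, e2⟩ <;> rw [e1, e2] <;> omega
      · rintro - s' ⟨H'', h1, h2, h3, h4⟩
        refine ⟨H'', ⟨h1.heap, h1.inv.mono ?_, h1.key⟩, ?_, ⟨h2.1.trans hi.1, h2.2.trans hi.2⟩,
          hP', ?_⟩
        · rintro r _ _ ⟨hr | ⟨q, hq, rfl⟩, hne⟩
          · exact .inl hr
          · rcases List.mem_cons.1 hq with rfl | hq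
            · exact absurd rfl hne
            · exact .inr ⟨q, hq, rfl⟩
        · unfold value at hθ ⊢
          rw [h3 a ha]
          exact hθ
        · simp only [energy] at *
          omega
    · refine ⟨H', ⟨hg.heap.congr _ _ _ rfl, hg.inv.mono ?_, hg.key⟩, hθ, ⟨hi.1, hi.2⟩, hP', ?_⟩
      · rintro r _ hr (hr' | ⟨q, hq, rfl⟩)
        · exact .inl hr'
        · rcases List.mem_cons.1 hq with rfl | hq
          -- A rule is passed over only if its other non-terminal has no cost. Then its right-hand
          -- side is not in `D`, and the invariant asks nothing of it.
          · refine absurd ((hg.inv.dom (other q)).2 (.inl ?_)) hb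
            rcases hlr q with ⟨e1, e2⟩ | ⟨e1, e2⟩
            · exact e2 ▸ hr.2
            · exact e1 ▸ hr.1
          · exact .inr ⟨q, hq, rfl⟩
      · simp only [energy] at *
        omega
  · rintro - _ ⟨t, ⟨H', hg, hθ, hi, -, hc⟩, rfl⟩
    refine ⟨H', ⟨hg.heap.congr _ _ _ rfl, hg.inv.mono ?_, hg.key⟩, hθ, ⟨hi.1, hi.2⟩, ?_⟩
    · rintro r _ _ (hr | ⟨q, hq, -⟩)
      · exact hr
      · simp at hq
    · simp only [energy, List.length_nil, mul_zero, add_zero] at *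
      omega

/-- A bound for the amortized time of removing an element from the queue. -/
def popTime (N : Type) [Fintype N] : ℕ := unit N * (11 * degrees N + 3)

/-- Each non-terminal outside `D` keeps `popTime N` in reserve for its removal, and 14 units for
each of its index entries. A rule has at most two entries, hence the factor 28. Every continuing
round enlarges `D`, so the size of its complement bounds the rounds; one more `popTime N` covers the
round that finds the queue empty. -/
theorem mainLoop_spec {P : Set (Rule N T)} {s : Mem N T} {H : Finset N} {L : List (Rule N T)}
    (hL : ∀ r, r ∈ L ↔ r ∈ P) (hidx : Index L s.withFirst s.withSecond)
    (h : Good P s ∅ H 1 fun _ => False) :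
    wp (mainLoop ()) (fun _ s' => ∃ D θ, Inv P s'.cost s'.chosen D ∅ θ (fun _ => False) ∧
      s'.clock ≤ s.clock + energy s H + popTime N * (Fintype.card N + 1) +
        28 * unit N * L.length) s := by
  have hunit : unit N = 20 * (Fintype.card N + 1) := rfl
  have hpop : popTime N = unit N * (11 * degrees N + 2) + unit N := by
    rw [popTime]; ring
  set len : N → ℕ := fun x => (s.withFirst x).length + (s.withSecond x).length with hlen
  set C := s.clock + energy s H + popTime N * Fintype.card N + 28 * unit N * L.length with hC
  suffices hs : wp (mainLoop ()) (fun _ s' => ∃ D θ,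
      Inv P s'.cost s'.chosen D ∅ θ (fun _ => False) ∧ s'.clock ≤ C + popTime N) s by
    refine wp_mono hs ?_
    rintro - s' ⟨D, θ, h1, h2⟩
    refine ⟨D, θ, h1, ?_⟩
    rw [mul_add, mul_one]
    omega
  refine wp_loop_of_index (fun n _ t => ∃ D H θ, Good P t D H θ (fun _ => False) ∧
    SameIndex s t ∧ Dᶜ.card = n ∧
    t.clock + energy t H + popTime N * Dᶜ.card + 14 * unit N * ∑ x ∈ Dᶜ, len x ≤ C) ?_
    (Fintype.card N) () s ⟨∅, H, 1, h, ⟨rfl, rfl⟩, by simp, ?_⟩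
  · rintro n - t ⟨D, H, θ, hg, hi, rfl, hc⟩
    rw [wp_bind]
    refine wp_mono (extractMin_spec hg.heap) ?_
    rintro o t₁ ⟨hf, hkey, ho⟩
    cases o with
    | none =>
      obtain ⟨rfl, ho⟩ := ho
      simp only [wp_pure]
      refine ⟨D, θ, ?_, ?_⟩
      · rw [hf.cost, hf.chosen]
        exact hg.inv
      · omega
    | some a =>
      obtain ⟨haH, hmin, hheap, hc₁⟩ := ho
      have haD : a ∉ D := fun haD => hg.inv.disjoint a haD haH
      rw [hg.key] at hmin
      have hfirst : t₁.withFirst = s.withFirst := hf.withFirst.trans hi.withFirst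
      have hsecond : t₁.withSecond = s.withSecond := hf.withSecond.trans hi.withSecond
      have hidx₁ : Index L t₁.withFirst t₁.withSecond := by rwa [hfirst, hsecond]
      -- The rules made pending are those in the two lists of `a`. The first inner loop settles one
      -- disjunct, the second the other; a rule `c ⟶ a a` occurs in both.
      have hpops : Inv P t₁.cost t₁.chosen (Insert.insert a D) (H.erase a) (value t₁.cost a)
          fun r => (∃ p ∈ t₁.withSecond a, r = .pair p.1 p.2 a) ∨
            ∃ p ∈ t₁.withFirst a, r = .pair p.1 a p.2 := by
        rw [hf.cost, hf.chosen]
        refine hg.inv.pop haH hmin ?_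
        rintro (⟨c, σ⟩ | ⟨c, x, y⟩) hr hD hn
        · exact ⟨trivial, id⟩
        · refine ⟨⟨(Finset.mem_insert.1 hD.1).resolve_left ?_,
            (Finset.mem_insert.1 hD.2).resolve_left ?_⟩, id⟩
          · rintro rfl
            exact hn (.inr ⟨(c, y), (hidx₁.mem_first _ _ _).2 ((hL _).2 hr), rfl⟩)
          · rintro rfl
            exact hn (.inl ⟨(c, x), (hidx₁.mem_second _ _ _).2 ((hL _).2 hr), rfl⟩)
      have hg₁ : Good P t₁ _ _ _ _ := ⟨hheap, hpops, by rw [hkey, hg.key, hf.cost]⟩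
      simp only [wp_bind, wp_rd, wp_pure]
      refine wp_mono (produceLoop_spec (fun p : N × N => p.1) (fun p => p.2) (fun _ => a) (fun p => p.2)
        (fun r => ∃ p ∈ t₁.withSecond a, r = .pair p.1 p.2 a) (Finset.mem_insert_self a D)
        (fun p => .inl ⟨rfl, rfl⟩) (fun p hp => (hL _).1 ((hidx₁.mem_first _ _ _).1 hp)) rfl
        (hg₁.clock _)) ?_
      rintro - t₂ ⟨H₂, hg₂, hθ₂, hi₂, hc₂⟩
      have hsecond₂ : t₂.withSecond = s.withSecond := hi₂.withSecond.trans hsecond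
      have hidx₂ : Index L t₂.withFirst t₂.withSecond := by
        rwa [hi₂.withFirst, hi₂.withSecond]
      refine wp_mono (produceLoop_spec (fun p : N × N => p.1) (fun p => p.2) (fun p => p.2) (fun _ => a)
        (fun _ => False) (Finset.mem_insert_self a D)
        (fun p => .inr ⟨rfl, rfl⟩) (fun p hp => (hL _).1 ((hidx₂.mem_second _ _ _).1 hp)) hθ₂
        ⟨hg₂.heap.congr _ _ _ rfl, hg₂.inv.mono fun _ _ _ hr => .inr (hi₂.withSecond ▸ hr), hg₂.key⟩) ?_
      rintro - t₃ ⟨H₃, hg₃, -, hi₃, hc₃⟩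
      have hmem : a ∈ Dᶜ := Finset.mem_compl.2 haD
      have hcard := Finset.card_erase_add_one hmem
      have hsum := Finset.add_sum_erase _ len hmem
      rw [← Finset.compl_insert] at hcard hsum
      refine ⟨_, Nat.lt_of_lt_of_eq (Nat.lt_succ_self _) hcard, _, H₃, _, hg₃,
        ⟨hi₃.1.trans (hi₂.1.trans hfirst), hi₃.2.trans hsecond₂⟩, rfl, ?_⟩
      rw [← hcard, ← hsum] at hc
      simp only [hlen, mul_add, mul_one, energy, hfirst, hsecond₂] at *
      omega
  · have h1 : ∑ x, len x ≤ 2 * L.length := by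
      rw [hlen, Finset.sum_add_distrib]
      exact hidx.sum_le
    have h2 := Nat.mul_le_mul_left (14 * unit N) h1
    rw [Finset.compl_empty, Finset.card_univ, hC]
    have h3 : 14 * unit N * (2 * L.length) = 28 * unit N * L.length := by ring
    omega

theorem Good.init (P : Set (Rule N T)) (L : List (Rule N T)) {s : Mem N T} {c : ℕ}
    {first second : N → List (N × N)} (hP : ∀ r ∈ P, r ∈ L)
    (hs : s = { Mem.blank N T with clock := c, withFirst := first, withSecond := second }) :
    Good P s ∅ ∅ 1 (· ∈ L) := by
  subst hs
  refine ⟨⟨⟨⟨?_, ?_, ?_, ?_, ?_, ?_, ⟨fun _ => 0, ?_⟩, ?_⟩, ?_, ?_, ?_, ?_, ?_⟩, ?_, ?_, ?_⟩,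
    ⟨?_, ?_, ?_, ?_, ?_, ?_, ?_, ?_, ?_, ?_, ?_, ?_, ?_, ?_⟩, rfl⟩ <;>
    simp [Mem.blank, Layered, value]
  · exact fun r hr _ => hP r hr

theorem algorithm_spec {P : Set (Rule N T)} {L : List (Rule N T)} (hL : ∀ r, r ∈ L ↔ r ∈ P) :
    ∃ (S : Set (Rule N T)) (final : Mem N T),
      (algorithm L).run (Mem.blank N T) = some (S, final) ∧
      (∃ D θ, Inv P final.cost final.chosen D ∅ θ (fun _ => False)) ∧
      S = {r | ∃ a, final.chosen a = some r} ∧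
      final.clock ≤ 11 * Fintype.card N + 3 * L.length + 3 + 34 * unit N * L.length +
        popTime N * (Fintype.card N + 1) := by
  suffices h : wp (algorithm L) (fun S final =>
      (∃ D θ, Inv P final.cost final.chosen D ∅ θ (fun _ => False)) ∧
      S = {r | ∃ a, final.chosen a = some r} ∧
      final.clock ≤ 11 * Fintype.card N + 3 * L.length + 3 + 34 * unit N * L.length +
        popTime N * (Fintype.card N + 1)) (Mem.blank N T) from h
  simp only [algorithm, wp_bind, wp_charge, wp_get, wp_pure]
  refine wp_mono (buildIndex_spec L _ rfl rfl) ?_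
  rintro - s ⟨c, first, second, hs, hidx, hc⟩
  have hg := Good.init P L (fun r hr => (hL r).2 hr) hs
  have hv : ∀ x, value s.cost x ≤ 1 := fun x => by simp [hs, Mem.blank, value]
  have he : energy s ∅ = 0 := by simp [hs, energy, tops, marks, Mem.blank]
  have hc' : s.clock ≤ 2 + 10 * Fintype.card N + 3 * L.length := by
    rw [hs]
    simp only [Mem.blank] at hc ⊢
    omega
  refine wp_mono (firstLoop_spec (fun r hr => (hL r).1 hr) hg hv) ?_
  rintro - t ⟨H, hgt, hi, hct⟩
  rw [← show s.withFirst = first by rw [hs], ← show s.withSecond = second by rw [hs],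
    ← hi.withFirst, ← hi.withSecond] at hidx
  refine wp_mono (mainLoop_spec hL hidx hgt) ?_
  rintro - u ⟨D, θ, hinv, hcu⟩
  refine ⟨⟨D, θ, hinv⟩, trivial, ?_⟩
  have h1 : 34 * unit N * L.length = 28 * unit N * L.length + 6 * unit N * L.length := by ring
  omega

end algorithm
-- From the final invariant to a minimizing set of rules.
section grammar
variable {N T : Type}

theorem Derives.mono {P Q : Set (Rule N T)} (h : P ⊆ Q) {u v : List (Symbol T N)}
    (huv : Derives P u v) : Derives Q u v :=
  Relation.ReflTransGen.mono (r := Step P) (p := Step Q)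
    (fun _ _ ⟨r, hr, hs⟩ => ⟨r, h hr, hs⟩) _ _ huv

theorem Derives.append {P : Set (Rule N T)} {u v u' v' : List (Symbol T N)} (h : Derives P u v)
    (h' : Derives P u' v') : Derives P (u ++ u') (v ++ v') := by
  refine Relation.ReflTransGen.trans (b := v ++ u') ?_ ?_
  · exact Relation.ReflTransGen.lift (r := Step P) (p := Step P) (· ++ u')
      (fun _ _ ⟨r, hr, hs⟩ => ⟨r, hr, hs.append_right u'⟩) _ _ h
  · exact Relation.ReflTransGen.lift (r := Step P) (p := Step P) (v ++ ·)
      (fun _ _ ⟨r, hr, hs⟩ => ⟨r, hr, hs.append_left v⟩) _ _ h'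

theorem Derives.of_rule {P : Set (Rule N T)} {r : Rule N T} (hr : r ∈ P) :
    Derives P [.nonterminal r.head] r.toContextFreeRule.output := by
  refine .single ⟨r, hr, ?_⟩
  rw [ContextFreeRule.rewrites_iff]
  cases r <;> exact ⟨[], [], rfl, by simp⟩

/-- A weight of the symbols that no rule decreases gives a bound for derivations. -/
theorem Derives.sum_le {M : Type} [AddMonoid M] [PartialOrder M] [AddLeftMono M] [AddRightMono M]
    {P : Set (Rule N T)} (w : Symbol T N → M)
    (hw : ∀ r ∈ P, w (.nonterminal r.head) ≤ (r.toContextFreeRule.output.map w).sum)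
    {u v : List (Symbol T N)} (h : Derives P u v) : (u.map w).sum ≤ (v.map w).sum := by
  induction h with
  | refl => exact le_rfl
  | tail _ hs ih =>
    refine ih.trans ?_
    obtain ⟨r, hr, hs⟩ := hs
    obtain ⟨p, q, rfl, rfl⟩ := ContextFreeRule.rewrites_iff.1 hs
    have h1 := hw r hr
    have h2 : r.toContextFreeRule.input = r.head := by cases r <;> rfl
    simp only [List.map_append, List.sum_append, List.map_cons, List.map_nil, List.sum_cons,
      List.sum_nil, add_zero, h2]
    gcongr

/-- Strings for the symbols that all rules respect are invariant under derivations. -/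
theorem Derives.flatMap_eq {P : Set (Rule N T)} (w : Symbol T N → List T)
    (hw : ∀ r ∈ P, w (.nonterminal r.head) = r.toContextFreeRule.output.flatMap w)
    {u v : List (Symbol T N)} (h : Derives P u v) : u.flatMap w = v.flatMap w := by
  induction h with
  | refl => rfl
  | tail _ hs ih =>
    rw [ih]
    obtain ⟨r, hr, hs⟩ := hs
    obtain ⟨p, q, rfl, rfl⟩ := ContextFreeRule.rewrites_iff.1 hs
    have h1 := hw r hr
    have h2 : r.toContextFreeRule.input = r.head := by cases r <;> rfl
    simp [h2, h1]

/-- A rank of the non-terminals that decreases from the left-hand to the right-hand side of the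
rules rules out recursion. -/
theorem nonRecursive_of_rank {P : Set (Rule N T)} (rank : N → ℕ)
    (h : ∀ r ∈ P, RhsAll (fun y => rank y < rank r.head) r) : NonRecursive P := by
  rintro a - ⟨s₁, s₂, hd⟩
  have hout : ∀ r ∈ P, ∀ b, .nonterminal b ∈ r.toContextFreeRule.output →
      rank b < rank r.head := by
    intro r hr b hb
    have h1 := h r hr
    cases r with
    | term => simp [Rule.toContextFreeRule] at hb
    | pair c x y =>
      simp only [Rule.toContextFreeRule, List.mem_cons, Symbol.nonterminal.injEq,
        List.not_mem_nil, or_false] at hb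
      rcases hb with rfl | rfl
      · exact h1.1
      · exact h1.2
  obtain ⟨u, ⟨r, hr, hs⟩, hu⟩ := Relation.TransGen.head'_iff.1 hd
  -- The first step can only rewrite `a` itself; from then on all non-terminals in the string have
  -- smaller rank than `a`.
  suffices H : ∀ v, Derives P u v → ∀ b, .nonterminal b ∈ v → rank b < rank a from
    lt_irrefl _ (H _ hu a (by simp))
  intro v hv
  induction hv with
  | refl =>
    intro b hb
    obtain ⟨p, q, hpq, rfl⟩ := ContextFreeRule.rewrites_iff.1 hs
    have h2 : r.toContextFreeRule.input = r.head := by cases r <;> rfl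
    rw [h2, List.append_assoc, List.singleton_append, eq_comm, List.append_eq_singleton_iff] at hpq
    simp at hpq
    obtain ⟨rfl, rfl, rfl⟩ := hpq
    exact hout r hr b (by simpa using hb)
  | tail _ hs ih =>
    intro b hb
    obtain ⟨r, hr, hs⟩ := hs
    obtain ⟨p, q, rfl, rfl⟩ := ContextFreeRule.rewrites_iff.1 hs
    have h2 : r.toContextFreeRule.input = r.head := by cases r <;> rfl
    rw [h2] at ih
    simp only [List.mem_append] at hb
    rcases hb with (hb | hb) | hb
    · exact ih b (by simp [hb])
    · exact (hout r hr b hb).trans (ih r.head (by simp))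
    · exact ih b (by simp [hb])

/-- The string of a non-terminal for a choice of rules, computed to the given depth. -/
def unfoldString (chosen : N → Option (Rule N T)) : ℕ → N → List T
  | 0, _ => []
  | k + 1, a => match chosen a with
    | none => []
    | some (.term _ t) => [t]
    | some (.pair _ b c) => unfoldString chosen k b ++ unfoldString chosen k c

namespace Inv
variable [DecidableEq N] {P : Set (Rule N T)} {cost : N → Option ℕ}
  {chosen : N → Option (Rule N T)} {D : Finset N} {θ : ℕ}

/-- With an empty queue the domain of the costs is `D`, and no rule is pending. -/
theorem le_of_rhs (h : Inv P cost chosen D ∅ θ fun _ => False) {r : Rule N T} (hr : r ∈ P)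
    (hrhs : RhsAll (fun y => (cost y).isSome) r) :
    (cost r.head).isSome ∧ value cost r.head ≤ bound cost r := by
  have hD : RhsAll (· ∈ D) r :=
    hrhs.imp fun x hx => ((h.dom x).1 hx).resolve_right (Finset.notMem_empty x)
  exact ⟨h.closed_dom r hr hD id, h.closed r hr hD id⟩

theorem value_eq (h : Inv P cost chosen D ∅ θ fun _ => False) {a : N} {r : Rule N T}
    (hr : chosen a = some r) : value cost a = bound cost r := by
  have h1 := (h.le_of_rhs (h.chosen_mem a r hr) (h.chosen_rhs a r hr)).2
  rw [h.chosen_head a r hr] at h1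
  exact h1.antisymm (h.chosen_le a r hr)

/-- The cost of `a` is the sum of two positive costs, so it exceeds both. -/
theorem rank (h : Inv P cost chosen D ∅ θ fun _ => False) {a : N} {r : Rule N T}
    (hr : chosen a = some r) : RhsAll (fun y => value cost y < value cost a) r := by
  have h1 := h.value_eq hr
  have h2 := h.chosen_rhs a r hr
  cases r with
  | term => trivial
  | pair _ b c =>
    have h3 := h.pos b h2.1
    have h4 := h.pos c h2.2
    simp only [bound] at h1
    exact ⟨by omega, by omega⟩

/-- Costs drop along chosen rules, so a depth equal to the cost already reaches all leaves. This
independence of depth turns the bounded unfolding into a solution of the equations in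
`exists_string`. -/
theorem unfoldString_eq (h : Inv P cost chosen D ∅ θ fun _ => False) :
    ∀ (k j : ℕ) (a : N), (cost a).isSome → value cost a ≤ k → value cost a ≤ j →
      unfoldString chosen k a = unfoldString chosen j a
  | 0, _, a, ha, hk, _ => absurd (h.pos a ha) (by omega)
  | _, 0, a, ha, _, hj => absurd (h.pos a ha) (by omega)
  | k + 1, j + 1, a, ha, hk, hj => by
    obtain ⟨r, hr⟩ := h.exists_chosen a ha
    have h1 := h.rank hr
    have h2 := h.chosen_rhs a r hr
    rw [unfoldString, unfoldString, hr]
    cases r with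
    | term => rfl
    | pair _ b c =>
      have h3 := h1.1
      have h4 := h1.2
      dsimp only at h3 h4 ⊢
      rw [unfoldString_eq h k j b h2.1 (by omega) (by omega),
        unfoldString_eq h k j c h2.2 (by omega) (by omega)]

/-- The strings that the chosen rules give. -/
theorem exists_string (h : Inv P cost chosen D ∅ θ fun _ => False) :
    ∃ w : Symbol T N → List T, (∀ t, w (.terminal t) = [t]) ∧
      ∀ a r, chosen a = some r → w (.nonterminal a) = r.toContextFreeRule.output.flatMap w := by
  refine ⟨fun x => match x with
    | .terminal t => [t]
    | .nonterminal a => unfoldString chosen (value cost a) a, fun _ => rfl, ?_⟩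
  intro a r hr
  have h1 := h.rank hr
  have h2 := h.chosen_rhs a r hr
  obtain ⟨k, hk⟩ := Nat.exists_eq_add_of_le' (h.pos a (h.chosen_dom a r hr))
  dsimp only
  rw [hk] at h1 ⊢
  rw [unfoldString, hr]
  cases r with
  | term => rfl
  | pair _ b c =>
    have h3 := h1.1
    have h4 := h1.2
    simp only [Rule.toContextFreeRule, List.flatMap_cons, List.flatMap_nil, List.append_nil]
    rw [h.unfoldString_eq k _ b h2.1 (by omega) le_rfl,
      h.unfoldString_eq k _ c h2.2 (by omega) le_rfl]

theorem derives (h : Inv P cost chosen D ∅ θ fun _ => False) {w : Symbol T N → List T}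
    (hw : ∀ a r, chosen a = some r → w (.nonterminal a) = r.toContextFreeRule.output.flatMap w)
    (ht : ∀ t, w (.terminal t) = [t]) (a : N) (ha : (cost a).isSome) :
    Derives {r | ∃ a, chosen a = some r} [.nonterminal a] ((w (.nonterminal a)).map .terminal) ∧
      (w (.nonterminal a)).length = value cost a := by
  induction hn : value cost a using Nat.strong_induction_on generalizing a with
  | _ n ih =>
  subst hn
  obtain ⟨r, hr⟩ := h.exists_chosen a ha
  have h1 := h.rank hr
  have h2 := h.chosen_rhs a r hr
  have h3 := h.value_eq hr
  have h4 : Derives {r | ∃ a, chosen a = some r} [.nonterminal r.head] _ := .of_rule ⟨a, hr⟩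
  rw [h.chosen_head a r hr] at h4
  rw [hw a r hr, h3]
  cases r with
  | term _ t =>
    simp only [Rule.toContextFreeRule, List.flatMap_cons, List.flatMap_nil, List.append_nil,
      ht] at h4 ⊢
    exact ⟨h4, rfl⟩
  | pair _ b c =>
    obtain ⟨hb, hb'⟩ := ih _ h1.1 b h2.1 rfl
    obtain ⟨hc, hc'⟩ := ih _ h1.2 c h2.2 rfl
    simp only [Rule.toContextFreeRule, List.flatMap_cons, List.flatMap_nil, List.append_nil,
      List.map_append, List.length_append, bound] at h4 ⊢
    exact ⟨h4.trans (hb.append hc), by rw [hb', hc']⟩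

/-- The weight `⊤` for non-terminals without a cost puts both conclusions into one inequality: the
weight of `a` is at most the finite length of `w`, so `a` has a cost. -/
theorem value_le_length (h : Inv P cost chosen D ∅ θ fun _ => False) {a : N} {w : List T}
    (hw : w ∈ languageOf P a) : (cost a).isSome ∧ value cost a ≤ w.length := by
  let wt : Symbol T N → ℕ∞ := fun x => match x with
    | .terminal _ => 1
    | .nonterminal b => if (cost b).isSome then (value cost b : ℕ∞) else ⊤
  have h1 : ([Symbol.nonterminal a].map wt).sum ≤ ((w.map Symbol.terminal).map wt).sum := by
    refine Derives.sum_le wt ?_ hw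
    intro r hr
    by_cases hrhs : RhsAll (fun y => (cost y).isSome) r
    · obtain ⟨h2, h3⟩ := h.le_of_rhs hr hrhs
      have h3' : (value cost r.head : ℕ∞) ≤ (bound cost r : ℕ) := by exact_mod_cast h3
      cases r with
      | term => simpa [wt, Rule.toContextFreeRule, bound, h2] using h3'
      | pair c x y =>
        simpa [wt, Rule.toContextFreeRule, bound, h2, hrhs.1, hrhs.2] using h3'
    · cases r with
      | term => exact absurd trivial hrhs
      | pair c x y =>
        simp only [RhsAll, not_and_or] at hrhs
        rcases hrhs with h2 | h2 <;> simp [wt, Rule.toContextFreeRule, h2]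
  have h2 : ((w.map Symbol.terminal).map wt).sum = (w.length : ℕ∞) := by
    simp [wt, Function.comp_def]
  rw [h2] at h1
  by_cases ha : (cost a).isSome
  · refine ⟨ha, ?_⟩
    simpa [wt, ha] using h1
  · simp [wt, ha] at h1

theorem isMinimizing (h : Inv P cost chosen D ∅ θ fun _ => False) :
    IsMinimizing P {r | ∃ a, chosen a = some r} := by
  obtain ⟨w, ht, hw⟩ := h.exists_string
  have hsub : {r | ∃ a, chosen a = some r} ⊆ P := fun r ⟨a, hr⟩ => h.chosen_mem a r hr
  have hhead : ∀ {a r}, chosen a = some r → chosen r.head = some r := fun {a r} hr => by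
    rwa [h.chosen_head a r hr]
  refine ⟨hsub, ⟨?_, ?_, ?_⟩, ?_⟩
  · refine nonRecursive_of_rank (value cost) ?_
    rintro r ⟨a, hr⟩
    exact h.rank (hhead hr)
  · rintro _ ⟨r, ⟨a, hr⟩, rfl⟩
    refine ⟨r, ⟨⟨a, hr⟩, rfl⟩, ?_⟩
    rintro r' ⟨⟨a', hr'⟩, he⟩
    have h1 := hhead hr'
    rw [he, hhead hr] at h1
    exact (Option.some.inj h1).symm
  · rintro _ ⟨r, ⟨a, hr⟩, rfl⟩
    exact ⟨_, (h.derives hw ht _ (h.chosen_dom _ _ (hhead hr))).1⟩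
  · rintro a ⟨u, hu⟩
    have ha := (h.value_le_length hu).1
    obtain ⟨h1, h2⟩ := h.derives hw ht a ha
    refine ⟨w (.nonterminal a), ⟨h1, ?_⟩, ⟨w (.nonterminal a), h1.mono hsub, rfl⟩, ?_⟩
    · intro w' hw'
      -- The substitution `w` is constant along the derivation and fixes strings over the alphabet,
      -- so the derived string is that of `a`.
      have h3 := hw'.flatMap_eq w fun r hr => hw _ _ (hhead hr.choose_spec)
      simpa [List.flatMap_map, ht] using h3.symm
    · rintro _ ⟨v, hv, rfl⟩
      rw [h2]
      exact (h.value_le_length hv).2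

end Inv
end grammar

/-! ### The numerical estimate and the assembly of the theorem. -/

theorem exists_time_bound : ∃ C : ℝ, 0 < C ∧ ∀ (N : Type) [Fintype N] (p : ℕ),
    (Fintype.card N = 0 → p = 0) →
    ((11 * Fintype.card N + 3 * p + 3 + 34 * unit N * p + popTime N * (Fintype.card N + 1) : ℕ) :
      ℝ) ≤ C * ((Fintype.card N : ℝ) *
        ((Fintype.card N : ℝ) * Real.log (Fintype.card N : ℝ) + (p : ℝ)) + 1) := by
  refine ⟨20000, by norm_num, ?_⟩
  intro N _ p hp
  simp only [popTime, unit, degrees]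
  generalize Fintype.card N = n at *
  -- For `n ≤ 1` the logarithmic term vanishes. The summand 1 must then absorb the constants, and
  -- for `n = 0` this needs `p = 0`.
  rcases Nat.lt_or_ge n 2 with hn | hn
  · obtain rfl | rfl : n = 0 ∨ n = 1 := by omega
    · simp [hp rfl]
      norm_num
    · have hp0 : (0 : ℝ) ≤ p := by positivity
      simp
      linarith
  · have hn' : (2 : ℝ) ≤ n := by exact_mod_cast hn
    have hp0 : (0 : ℝ) ≤ p := by positivity
    have hlog2 : (1 / 2 : ℝ) ≤ Real.log 2 := by linarith [Real.log_two_gt_d9]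
    have hlogn : Real.log 2 ≤ Real.log n := Real.log_le_log (by norm_num) hn'
    have hlog : (Nat.log 2 n : ℝ) ≤ 2 * Real.log n := by
      have h1 : ((2 : ℝ) ^ Nat.log 2 n) ≤ n := by
        exact_mod_cast Nat.pow_log_le_self 2 (by omega)
      have h2 := Real.log_le_log (by positivity) h1
      rw [Real.log_pow] at h2
      have h3 : (0 : ℝ) ≤ Nat.log 2 n := by positivity
      nlinarith
    push_cast
    set ℓ := Real.log n with hℓ
    set m : ℝ := (Nat.log 2 n : ℝ) with hm
    have e1 : (1 : ℝ) / 2 ≤ ℓ := hlog2.trans hlogn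
    have e2 : (n : ℝ) + 1 ≤ 2 * n := by linarith
    -- The bounds `m ≤ 2 * ℓ` and `1 / 2 ≤ ℓ` let the logarithm absorb the additive constants.
    have e3 : 11 * (2 * m + 2) + 3 ≤ 100 * ℓ := by linarith
    have e4 : 20 * ((n : ℝ) + 1) * (11 * (2 * m + 2) + 3) * (n + 1) ≤
        20 * (2 * n) * (100 * ℓ) * (2 * n) := by gcongr
    have e5 : 34 * (20 * ((n : ℝ) + 1)) * p ≤ 34 * (20 * (2 * n)) * p := by gcongr
    have e6 : (p : ℝ) ≤ n * p := by nlinarith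
    have e7 : (n : ℝ) ≤ n * n * ℓ := by nlinarith [mul_nonneg (by linarith : (0 : ℝ) ≤ n) (by linarith : (0 : ℝ) ≤ n)]
    nlinarith

end MinCFG

theorem mainTheorem4 :
    ∃ C : ℝ, 0 < C ∧
      ∀ (N T : Type) [Fintype N] [DecidableEq N] (P : Finset (MinCFG.Rule N T))
        (L : List (MinCFG.Rule N T)), L.Nodup → (∀ r, r ∈ L ↔ r ∈ P) →
        ∃ (S : Set (MinCFG.Rule N T)) (final : MinCFG.Mem N T),
          (MinCFG.algorithm L).run (MinCFG.Mem.blank N T) = some (S, final) ∧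
          MinCFG.IsMinimizing (P : Set (MinCFG.Rule N T)) S ∧
          (final.clock : ℝ) ≤
            C * ((Fintype.card N : ℝ) *
              ((Fintype.card N : ℝ) * Real.log (Fintype.card N : ℝ) + (P.card : ℝ)) + 1) := by
  obtain ⟨C, hC, hbound⟩ := MinCFG.exists_time_bound
  refine ⟨C, hC, ?_⟩
  intro N T _ _ P L hL hP
  classical
  have hlen : L.length = P.card := by
    rw [← List.toFinset_card_of_nodup hL]
    congr 1
    ext r
    simp [hP]
  obtain ⟨S, final, hrun, ⟨D, θ, hinv⟩, rfl, hclock⟩ :=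
    MinCFG.algorithm_spec (P := (P : Set (MinCFG.Rule N T))) (L := L) (by simpa using hP)
  refine ⟨_, final, hrun, hinv.isMinimizing, ?_⟩
  rw [hlen] at hclock
  refine le_trans (Nat.cast_le.2 hclock) (hbound N P.card fun h0 => ?_)
  have : IsEmpty N := Fintype.card_eq_zero_iff.1 h0
  -- A rule has a head, so there are no rules when there are no non-terminals.
  exact Finset.card_eq_zero.2 (Finset.eq_empty_of_forall_notMem fun r _ => isEmptyElim r.head)
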